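/- Theorem (Uniform Theorem of Kurtz). $1\text{-}\mathsf{GEN}\le_{\mathrm W}(1-*)\text{-}\mathsf{WWKL}'$. Here the notions are as follows. * A representation of a set $X$ is a surjective partial map $\delta:\subseteq\mathbb N^{\mathbb N}\to X$; if $\delta(p)=x$, then $p$ is a name of $x$. A realizer of a partial multi-valued function $f:\subseteq X\rightrightarrows Y$ on represented spaces is a partial function $F:\subseteq\mathbb N^{\mathbb N}\to\mathbb N^{\mathbb N}$ such that, for every name $p$ of a point $x\in\mathrm{dom}(f)$, $F(p)$ is defined and is a name of some $y\in f(x)$. We write $f\le_{\mathrm W} g$ if there are computable partial functions $K,H:\subseteq\mathbb N^{\mathbb N}\to\mathbb N^{\mathbb N}$ such that $p\mapsto H\langle p,G(K(p))\rangle$ is a realizer of $f$ for every realizer $G$ of $g$. Here $\langle p,q\rangle(2k)=p(k)$, $\langle p,q\rangle(2k+1)=q(k)$. * The jump $f'$ of $f$ is the same multi-valued function, except that a name of an input $x$ is now a sequence $\langle p_0,p_1,p_2,\dots\rangle$ of elements of $\mathbb N^{\mathbb N}$ that converges, in the product topology, to a name of $x$ in the original sense. * For $q\in 2^{\mathbb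 N}$ let $U_i^q:=\{p\in 2^{\mathbb N}:\varphi_i^{\langle p,q\rangle}(0)\downarrow\}$, where $\varphi_i^{r}$ is the partial function computed by the $i$-th oracle program with oracle $r$. A point $p\in 2^{\mathbb N}$ is $1$-generic in $q$ if for every $i$ there is a finite prefix $w$ of $p$ with $w2^{\mathbb N}\subseteq U_i^q$ or $w2^{\mathbb N}\cap U_i^q=\emptyset$. The problem $1\text{-}\mathsf{GEN}:2^{\mathbb N}\rightrightarrows 2^{\mathbb N}$ is defined on all of $2^{\mathbb N}$ by $1\text{-}\mathsf{GEN}(q):=\{p: p\text{ is }1\text{-generic in }q\}$. Points of $2^{\mathbb N}$ are named by themselves. * A binary tree is a set $T$ of finite binary words closed under prefixes, named by its characteristic function; $[T]\subseteq 2^{\mathbb N}$ is its set of infinite paths and $\mu$ is the uniform measure on $2^{\mathbb N}$. The problem $(1-*)\text{-}\mathsf{WWKL}$ has as inputs the sequences $(T_n)_{n\in\mathbb N}$ of binary trees with $\mu([T_n])>1-2^{-n}$ for all $n\in\mathbb N$ (a name of a sequence being a sequence of names), and as admissible outputs for $(T_n)_n$ all pairs $(n,p)$ with $n\in\mathbb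 N$ and $p\in[T_n]$; the pair $(n,p)$ is named by the number $n$ followed by $p$. -/

import Mathlib

open MeasureTheory Filter Topology

namespace Weihrauch

/-! ### Oracle computation -/

/-- Programs for partial recursive functions with an oracle `ℕ → ℕ`: Kleene's schemes (in the
form of `Nat.RecursiveIn`) together with an instruction that queries the oracle. -/
inductive OracleCode : Type
  | zero : OracleCode
  | succ : OracleCode
  | left : OracleCode
  | right : OracleCode
  | oracle : OracleCode
  | pair : OracleCode → OracleCode → OracleCode
  | comp : OracleCode → OracleCode → OracleCode
  | prec : OracleCode → OracleCode → OracleCode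
  | rfind : OracleCode → OracleCode

/-- `c.eval o` is the partial function computed by the program `c` with oracle `o`. -/
def OracleCode.eval (o : ℕ → ℕ) : OracleCode → ℕ →. ℕ
  | .zero => fun _ => Part.some 0
  | .succ => fun n => Part.some (n + 1)
  | .left => fun n => Part.some n.unpair.1
  | .right => fun n => Part.some n.unpair.2
  | .oracle => fun n => Part.some (o n)
  | .pair f h => fun n => Nat.pair <$> f.eval o n <*> h.eval o n
  | .comp f h => fun n => h.eval o n >>= f.eval o
  | .prec f h => fun p =>
      p.unpair.2.rec (f.eval o p.unpair.1) fun y IH => do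
        let i ← IH
        h.eval o (Nat.pair p.unpair.1 (Nat.pair y i))
  | .rfind f => fun a => Nat.rfind fun n => (fun m => decide (m = 0)) <$> f.eval o (Nat.pair a n)

/-- A partial function `F` on Baire space is computable if one fixed oracle program computes,
for every `p` in the domain of `F`, the sequence `F p` from the oracle `p`. -/
def ComputableFunctional (F : (ℕ → ℕ) →. (ℕ → ℕ)) : Prop :=
  ∃ c : OracleCode, ∀ p q, q ∈ F p → ∀ n, q n ∈ c.eval p n

/-- The pairing `⟨p, q⟩` of two sequences: `p` on even and `q` on odd positions. -/
def interleave (p q : ℕ → ℕ) : ℕ → ℕ :=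
  fun n => if n % 2 = 0 then p (n / 2) else q (n / 2)

/-- The `i`-th component of `p = ⟨p₀, p₁, p₂, …⟩`, where `p ⟨i, j⟩ = pᵢ j`. -/
def column (p : ℕ → ℕ) (i : ℕ) : ℕ → ℕ := fun j => p (Nat.pair i j)

/-! ### Represented spaces -/

/-- A representation of `X`, i.e. a surjective partial map from Baire space to `X`, given by its
graph: `δ.Names p x` says that `p` lies in the domain of `δ` and `δ p = x`. -/
structure Representation (X : Type*) where
  Names : (ℕ → ℕ) → X → Prop
  unique : ∀ p x y, Names p x → Names p y → x = y
  surjective : ∀ x, ∃ p, Names p x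

/-- The jump `δ ∘ lim` of a representation: a name of `x` is a sequence `⟨p₀, p₁, …⟩` of elements
of Baire space that converges to a `δ`-name of `x`. -/
def Representation.jump {X : Type*} (δ : Representation X) : Representation X where
  Names p x := ∃ q, Tendsto (column p) atTop (𝓝 q) ∧ δ.Names q x
  unique := by
    rintro p x y ⟨q, hq, hx⟩ ⟨r, hr, hy⟩
    obtain rfl := tendsto_nhds_unique hq hr
    exact δ.unique _ _ _ hx hy
  surjective x := by
    obtain ⟨q, hq⟩ := δ.surjective x
    refine ⟨fun n => q n.unpair.2, q, ?_, hq⟩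
    have h : column (fun n => q n.unpair.2) = fun _ => q := by
      funext i j
      simp [column]
    rw [h]
    exact tendsto_const_nhds

/-- The countable power `δ^ℕ`, representing sequences in `X`. -/
def Representation.seq {X : Type*} (δ : Representation X) : Representation (ℕ → X) where
  Names p x := ∀ i, δ.Names (column p i) (x i)
  unique p x y hx hy := funext fun i => δ.unique _ _ _ (hx i) (hy i)
  surjective x := by
    choose q hq using fun i => δ.surjective (x i)
    refine ⟨fun n => q n.unpair.1 n.unpair.2, fun i => ?_⟩
    have h : column (fun n => q n.unpair.1 n.unpair.2) i = q i := by
      funext j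
      simp [column]
    rw [h]
    exact hq i

/-- The infinite coproduct `⨆ₙ X = ⋃ₙ {n} × X` of copies of `X`, as the set `ℕ × X`:
a name of `(n, x)` is the number `n` followed by a name of `x`. -/
def Representation.natCoprod {X : Type*} (δ : Representation X) : Representation (ℕ × X) where
  Names p x := p 0 = x.1 ∧ δ.Names (fun n => p (n + 1)) x.2
  unique p x y hx hy := Prod.ext (hx.1.symm.trans hy.1) (δ.unique _ _ _ hx.2 hy.2)
  surjective x := by
    obtain ⟨q, hq⟩ := δ.surjective x.2
    exact ⟨fun n => Nat.casesOn n x.1 q, rfl, hq⟩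

/-- Cantor space `2^ℕ`. -/
abbrev Cantor : Type := ℕ → Bool

/-- The inclusion of Cantor space into Baire space. -/
def Cantor.toBaire (x : Cantor) : ℕ → ℕ := fun n => (x n).toNat

/-- The standard representation of Cantor space: `x` is named by itself. -/
def cantorRep : Representation Cantor where
  Names p x := p = x.toBaire
  unique p x y hx hy := by
    funext n
    have h := congrFun (hx.symm.trans hy) n
    revert h
    simp only [Cantor.toBaire]
    cases x n <;> cases y n <;> simp
  surjective x := ⟨_, rfl⟩

/-- The space `Tr` of binary trees: sets of finite binary words closed under prefixes. -/
abbrev BinTree : Type := Descriptive.tree Bool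

open Classical in
/-- The standard representation of `Tr`: a tree is named by its characteristic function, where
binary words are identified with their codes. -/
noncomputable def treeRep : Representation BinTree where
  Names p T := ∀ n, p n = if ∃ w ∈ T, Encodable.encode w = n then 1 else 0
  unique p S T hS hT := by
    ext w
    have key : ∀ R : BinTree, (∃ v ∈ R, Encodable.encode v = Encodable.encode w) ↔ w ∈ R :=
      fun R => ⟨fun ⟨v, hv, h⟩ => Encodable.encode_injective h ▸ hv, fun h => ⟨w, h, rfl⟩⟩
    have h := (hS (Encodable.encode w)).symm.trans (hT (Encodable.encode w))
    rw [key, key] at h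
    by_cases h₁ : w ∈ S <;> by_cases h₂ : w ∈ T <;> simp_all
  surjective T := ⟨_, fun _ => rfl⟩

/-! ### Multi-valued functions and Weihrauch reducibility -/

/-- A partial multi-valued function from `X` to `Y`. -/
structure MultiFun (X Y : Type*) where
  dom : Set X
  val : X → Set Y

/-- `F` is a realizer of `f`: for each name `p` of a point `x` in the domain of `f`, `F p` is
defined and is a name of some point in `f x`. -/
def Realizes {X Y : Type*} (δX : Representation X) (δY : Representation Y)
    (F : (ℕ → ℕ) →. (ℕ → ℕ)) (f : MultiFun X Y) : Prop :=
  ∀ p x, δX.Names p x → x ∈ f.dom → ∃ q ∈ F p, ∃ y ∈ f.val x, δY.Names q y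

/-- Weihrauch reducibility `f ≤W g`: there are computable `K, H` such that `H⟨id, GK⟩` realizes
`f` whenever `G` realizes `g`. -/
def Reducible {X Y Z W : Type*} (δX : Representation X) (δY : Representation Y)
    (δZ : Representation Z) (δW : Representation W) (f : MultiFun X Y) (g : MultiFun Z W) : Prop :=
  ∃ K H : (ℕ → ℕ) →. (ℕ → ℕ), ComputableFunctional K ∧ ComputableFunctional H ∧
    ∀ G : (ℕ → ℕ) →. (ℕ → ℕ), Realizes δZ δW G g →
      Realizes δX δY
        (fun p => (K p).bind fun k => (G k).bind fun r => H (interleave p r)) f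

/-! ### 1-genericity -/

/-- The subset of Cantor space that is c.e. open in `q` and has index `c`:
the set of all `p` such that the program `c` with oracle `⟨p, q⟩` halts on input `0`. -/
def ceOpen (q : Cantor) (c : OracleCode) : Set Cantor :=
  {p | (c.eval (interleave p.toBaire q.toBaire) 0).Dom}

/-- `p` is 1-generic in `q`: for each `U` that is c.e. open in `q`, some prefix `w` of `p` satisfies
`w2^ℕ ⊆ U` or `w2^ℕ ∩ U = ∅`. Here `PiNat.cylinder p n` is `w2^ℕ` for the prefix `w` of `p` of
length `n`. -/
def IsOneGeneric (q p : Cantor) : Prop :=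
  ∀ c : OracleCode, ∃ n : ℕ,
    PiNat.cylinder p n ⊆ ceOpen q c ∨ PiNat.cylinder p n ∩ ceOpen q c = ∅

/-- The problem `1-GEN`. -/
def oneGEN : MultiFun Cantor Cantor where
  dom := Set.univ
  val q := {p | IsOneGeneric q p}

/-! ### Weak weak Kőnig's lemma -/

/-- The uniform measure on Cantor space (independent fair coin flips). -/
noncomputable def uniformMeasure : Measure Cantor :=
  Measure.infinitePi fun _ => (PMF.uniformOfFintype Bool).toMeasure

/-- The set `[T]` of infinite paths of `T`. -/
def paths (T : BinTree) : Set Cantor :=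
  {x | ∀ n : ℕ, List.ofFn (fun i : Fin n => x i) ∈ T}

/-- The problem `ε-WWKL`: given a tree `T` with `μ([T]) > ε`, find an infinite path of `T`. -/
noncomputable def epsWWKL (ε : ℝ) : MultiFun BinTree Cantor where
  dom := {T | ε < uniformMeasure.real (paths T)}
  val T := paths T

/-- The problem `(1-*)-WWKL`: given a sequence of trees `(Tₙ)` with `μ([Tₙ]) > 1 - 2⁻ⁿ` for all `n`,
find a number `n` together with an infinite path of `Tₙ`. -/
noncomputable def oneMinusStarWWKL : MultiFun (ℕ → BinTree) (ℕ × Cantor) where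
  dom := {T | ∀ n, T n ∈ (epsWWKL (1 - (1 / 2) ^ n)).dom}
  val T := {y | y.2 ∈ (epsWWKL (1 - (1 / 2) ^ y.1)).val (T y.1)}

end Weihrauch

/-!
The reduction is the *fireworks argument*: from a random sequence one computes a 1-generic
sequence with probability as close to one as desired, and failure of the computation can be
recognized with the help of a jump.

**The process.** There is a requirement for every index `i` of an open set `U i` that is c.e. in
the given `q`. A growing word is produced. At any time, requirement `i` conjectures that some
earlier prefix of the word has no extension in `U i`. Such a conjecture can be refuted by finding
an extension; then `i` conjectures the same about the current word. Only when conjecture number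
`k i` is refuted does `i` take the risk of assuming the opposite: it waits for an extension of the
current word in `U i` and moves there. If the process never waits in vain, then its output is
1-generic in `q`: either `i` has once waited successfully, and the output is in `U i`, or only
finitely many conjectures of `i` are refuted, and the last one is correct (`meets_requirement`).

**The probability.** With the other thresholds fixed, at most one value of `k i` makes `i` wait in
vain (`Stuck.unique`): the values of `k i` smaller than it lead to a successful wait, and with a
larger value `i` makes a correct conjecture at the same place. If `k i` is read off from a block of
`n + i + 2` random bits, then `i` gets stuck with probability at most `2⁻⁽ⁿ⁺ⁱ⁺²⁾`, since the
translates of the failure set by words on this block are disjoint (`measure_le_of_block_unique`).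
Hence the process fails with total probability at most `2⁻⁽ⁿ⁺¹⁾ < 2⁻ⁿ` (`lt_measure_reaches`).

**The reduction.** The random sequences for which the process runs forever are the paths of a tree
(`runTree`), which is the limit of the computable trees obtained by bounding the search for
extensions, because success of a bounded search is monotone in the bound. So the forward functional
computes a name in the sense of the jump (`forward_names`), and the backward functional runs the
process along a path that is returned (`backward_spec`).

**Computability.** A halting oracle computation uses a finite part of its oracle, and the finite
parts on which a given program halts are c.e.; so Mathlib's universal evaluation `evaln` of programs
without oracle also serves as a universal machine for oracle programs (`exists_index`). Conversely,
functionals that are given by primitive recursive functions of finite initial segments are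
computed by oracle programs (`computableFunctional_of_primrec`).
-/

namespace Weihrauch

/-! ### Initial segments -/

/-- The list of the first `n` values of `f`. -/
def initSeg {α : Type*} (f : ℕ → α) (n : ℕ) : List α := (List.range n).map f

section initSeg
variable {α : Type*}

@[simp] theorem length_initSeg (f : ℕ → α) (n : ℕ) : (initSeg f n).length = n := by
  simp [initSeg]

theorem getElem?_initSeg (f : ℕ → α) (n i : ℕ) :
    (initSeg f n)[i]? = if i < n then some (f i) else none := by
  by_cases h : i < n <;> simp [initSeg, h]

theorem getD_initSeg (f : ℕ → α) {n i : ℕ} (h : i < n) (d : α) :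
    (initSeg f n).getD i d = f i := by
  rw [List.getD_eq_getElem?_getD, getElem?_initSeg, if_pos h, Option.getD_some]

theorem initSeg_succ (f : ℕ → α) (n : ℕ) : initSeg f (n + 1) = initSeg f n ++ [f n] := by
  simp [initSeg, List.range_succ]

theorem initSeg_congr {f g : ℕ → α} {n : ℕ} (h : ∀ i < n, f i = g i) :
    initSeg f n = initSeg g n :=
  List.map_congr_left fun i hi => h i (List.mem_range.1 hi)

theorem initSeg_injOn {f g : ℕ → α} {n : ℕ} (h : initSeg f n = initSeg g n) :
    ∀ i < n, f i = g i := fun i hi => by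
  have := congrArg (·[i]?) h
  simpa only [getElem?_initSeg, if_pos hi, Option.some.injEq] using this

theorem initSeg_isPrefix (f : ℕ → α) {m n : ℕ} (h : m ≤ n) : initSeg f m <+: initSeg f n := by
  induction n, h using Nat.le_induction with
  | base => exact List.prefix_rfl
  | succ n _ ih => exact ih.trans (initSeg_succ f n ▸ List.prefix_append _ _)

theorem ofFn_eq_initSeg (f : ℕ → α) (n : ℕ) : List.ofFn (fun i : Fin n => f i) = initSeg f n := by
  apply List.ext_getElem? fun i => ?_
  rw [getElem?_initSeg, List.getElem?_ofFn]
  by_cases h : i < n <;> simp [h]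

theorem eq_initSeg_of_isPrefix {f : ℕ → α} {u : List α} {n : ℕ} (h : u <+: initSeg f n) :
    u = initSeg f u.length := by
  have hl : u.length ≤ n := by simpa using h.length_le
  exact (List.prefix_of_prefix_length_le h (initSeg_isPrefix f hl) (by simp)).eq_of_length (by simp)

end initSeg

/-! ### Finite use of oracle computations -/

namespace OracleCode

/-- Evaluation of an oracle program with a partial oracle: a query outside the domain of the
oracle makes the computation diverge. -/
def evalPart (o : ℕ → Part ℕ) : OracleCode → ℕ → Part ℕ
  | .zero => fun _ => Part.some 0
  | .succ => fun n => Part.some (n + 1)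
  | .left => fun n => Part.some n.unpair.1
  | .right => fun n => Part.some n.unpair.2
  | .oracle => o
  | .pair f h => fun n => Nat.pair <$> f.evalPart o n <*> h.evalPart o n
  | .comp f h => fun n => h.evalPart o n >>= f.evalPart o
  | .prec f h => fun p =>
      p.unpair.2.rec (f.evalPart o p.unpair.1) fun y IH => do
        let i ← IH
        h.evalPart o (Nat.pair p.unpair.1 (Nat.pair y i))
  | .rfind f => fun a =>
      Nat.rfind fun n => (fun m => decide (m = 0)) <$> f.evalPart o (Nat.pair a n)

theorem eval_eq_evalPart (o : ℕ → ℕ) (c : OracleCode) :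
    c.eval o = c.evalPart (fun n => Part.some (o n)) := by
  induction c with
  | zero | succ | left | right | oracle => rfl
  | pair f h hf hh | comp f h hf hh | prec f h hf hh => simp only [eval, evalPart, hf, hh]; rfl
  | rfind f hf => simp only [eval, evalPart, hf]; rfl

theorem mem_eval {o : ℕ → ℕ} {c : OracleCode} {a b : ℕ} :
    b ∈ c.eval o a ↔ b ∈ c.evalPart (fun n => Part.some (o n)) a := by
  rw [eval_eq_evalPart]

section mem
variable {o : ℕ → Part ℕ} {f h : OracleCode} {a b m : ℕ}

theorem mem_evalPart_pair :
    b ∈ (pair f h).evalPart o a ↔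
      ∃ x ∈ f.evalPart o a, ∃ y ∈ h.evalPart o a, Nat.pair x y = b := by
  have key : b ∈ ((f.evalPart o a).map Nat.pair).bind (fun g => (h.evalPart o a).map g) ↔
      ∃ x ∈ f.evalPart o a, ∃ y ∈ h.evalPart o a, Nat.pair x y = b := by
    simp only [Part.mem_bind_iff, Part.mem_map_iff]
    constructor
    · rintro ⟨_, ⟨x, hx, rfl⟩, y, hy, e⟩
      exact ⟨x, hx, y, hy, e⟩
    · rintro ⟨x, hx, y, hy, e⟩
      exact ⟨_, ⟨x, hx, rfl⟩, y, hy, e⟩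
  exact key

theorem mem_evalPart_comp :
    b ∈ (comp f h).evalPart o a ↔ ∃ x ∈ h.evalPart o a, b ∈ f.evalPart o x :=
  Part.mem_bind_iff

theorem evalPart_prec_zero :
    (prec f h).evalPart o (Nat.pair a 0) = f.evalPart o a := by
  simp [evalPart]

theorem mem_evalPart_prec_succ :
    b ∈ (prec f h).evalPart o (Nat.pair a (m + 1)) ↔
      ∃ x ∈ (prec f h).evalPart o (Nat.pair a m),
        b ∈ h.evalPart o (Nat.pair a (Nat.pair m x)) := by
  simp only [evalPart, Nat.unpair_pair]
  exact Part.mem_bind_iff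

theorem mem_evalPart_rfind :
    b ∈ (rfind f).evalPart o a ↔
      0 ∈ f.evalPart o (Nat.pair a b) ∧
        ∀ m < b, ∃ y ∈ f.evalPart o (Nat.pair a m), y ≠ 0 := by
  have key : b ∈ Nat.rfind (fun n => (f.evalPart o (Nat.pair a n)).map fun m => decide (m = 0)) ↔
      0 ∈ f.evalPart o (Nat.pair a b) ∧
        ∀ m < b, ∃ y ∈ f.evalPart o (Nat.pair a m), y ≠ 0 := by
    refine Nat.mem_rfind.trans (and_congr ?_ (forall_congr' fun m => forall_congr' fun _ => ?_))
    · exact (Part.mem_map_iff _).trans (by simp)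
    · exact (Part.mem_map_iff _).trans (by simp)
  exact key

end mem

theorem evalPart_mono {o o' : ℕ → Part ℕ} (ho : ∀ n, ∀ b ∈ o n, b ∈ o' n) (c : OracleCode) :
    ∀ a, ∀ b ∈ c.evalPart o a, b ∈ c.evalPart o' a := by
  induction c with
  | zero | succ | left | right => exact fun _ _ h => h
  | oracle => exact ho
  | pair f h hf hh =>
    intro a b
    simp only [mem_evalPart_pair]
    rintro ⟨x, hx, y, hy, e⟩
    exact ⟨x, hf _ _ hx, y, hh _ _ hy, e⟩
  | comp f h hf hh =>
    intro a b
    simp only [mem_evalPart_comp]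
    rintro ⟨x, hx, hb⟩
    exact ⟨x, hh _ _ hx, hf _ _ hb⟩
  | prec f h hf hh =>
    intro a
    rw [← Nat.pair_unpair a]
    generalize a.unpair.2 = m
    induction m with
    | zero => simpa only [evalPart_prec_zero] using hf _
    | succ m ih =>
      intro b
      simp only [mem_evalPart_prec_succ]
      rintro ⟨x, hx, hb⟩
      exact ⟨x, ih _ hx, hh _ _ hb⟩
  | rfind f hf =>
    intro a b
    simp only [mem_evalPart_rfind]
    rintro ⟨hb, H⟩
    refine ⟨hf _ _ hb, fun m hm => ?_⟩
    obtain ⟨y, hy, e⟩ := H m hm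
    exact ⟨y, hf _ _ hy, e⟩

/-- The restriction of an oracle to the numbers below `N`. -/
def restrict (o : ℕ → ℕ) (N : ℕ) : ℕ → Part ℕ := fun n => ⟨n < N, fun _ => o n⟩

theorem mem_restrict {o : ℕ → ℕ} {N n b : ℕ} : b ∈ restrict o N n ↔ n < N ∧ o n = b :=
  Part.mem_mk_iff.trans exists_prop

theorem evalPart_restrict_mono {o : ℕ → ℕ} {N M : ℕ} (h : N ≤ M) {c : OracleCode} {a b : ℕ}
    (hb : b ∈ c.evalPart (restrict o N) a) : b ∈ c.evalPart (restrict o M) a := by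
  refine evalPart_mono (fun n b hn => ?_) c a b hb
  rw [mem_restrict] at hn ⊢
  exact ⟨hn.1.trans_le h, hn.2⟩

/-- A halting oracle computation uses only finitely many values of the oracle. -/
theorem exists_restrict {o : ℕ → ℕ} (c : OracleCode) :
    ∀ a, ∀ b ∈ c.evalPart (fun n => Part.some (o n)) a,
      ∃ N, b ∈ c.evalPart (restrict o N) a := by
  induction c with
  | zero | succ | left | right => exact fun _ _ h => ⟨0, h⟩
  | oracle =>
    intro a b hb
    exact ⟨a + 1, mem_restrict.2 ⟨a.lt_succ_self, (Part.mem_some_iff.1 hb).symm⟩⟩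
  | pair f h hf hh =>
    intro a b
    simp only [mem_evalPart_pair]
    rintro ⟨x, hx, y, hy, rfl⟩
    obtain ⟨N, hN⟩ := hf _ _ hx
    obtain ⟨M, hM⟩ := hh _ _ hy
    exact ⟨max N M, x, evalPart_restrict_mono (le_max_left _ _) hN, y,
      evalPart_restrict_mono (le_max_right _ _) hM, rfl⟩
  | comp f h hf hh =>
    intro a b
    simp only [mem_evalPart_comp]
    rintro ⟨x, hx, hb⟩
    obtain ⟨N, hN⟩ := hh _ _ hx
    obtain ⟨M, hM⟩ := hf _ _ hb
    exact ⟨max N M, x, evalPart_restrict_mono (le_max_left _ _) hN,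
      evalPart_restrict_mono (le_max_right _ _) hM⟩
  | prec f h hf hh =>
    intro a
    rw [← Nat.pair_unpair a]
    generalize a.unpair.2 = m
    induction m with
    | zero => simpa only [evalPart_prec_zero] using hf _
    | succ m ih =>
      intro b
      simp only [mem_evalPart_prec_succ]
      rintro ⟨x, hx, hb⟩
      obtain ⟨N, hN⟩ := ih _ hx
      obtain ⟨M, hM⟩ := hh _ _ hb
      exact ⟨max N M, x, evalPart_restrict_mono (le_max_left _ _) hN,
        evalPart_restrict_mono (le_max_right _ _) hM⟩
  | rfind f hf =>
    intro a b
    simp only [mem_evalPart_rfind]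
    rintro ⟨hb, H⟩
    obtain ⟨N, hN⟩ := hf _ _ hb
    have : ∀ m, ∃ M, m < b → ∃ y ∈ f.evalPart (restrict o M) (Nat.pair a m), y ≠ 0 := by
      intro m
      by_cases hm : m < b
      · obtain ⟨y, hy, e⟩ := H m hm
        obtain ⟨M, hM⟩ := hf _ _ hy
        exact ⟨M, fun _ => ⟨y, hM, e⟩⟩
      · exact ⟨0, fun h => absurd h hm⟩
    choose M hM using this
    refine ⟨max N ((Finset.range b).sup M),
      evalPart_restrict_mono (le_max_left _ _) hN, fun m hm => ?_⟩
    obtain ⟨y, hy, e⟩ := hM m hm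
    exact ⟨y, evalPart_restrict_mono
      ((Finset.le_sup (f := M) (Finset.mem_range.2 hm)).trans (le_max_right _ _)) hy, e⟩

/-- The functions computed by a fixed oracle program from a uniformly partial recursive family of
partial oracles are uniformly partial recursive. -/
theorem evalPart_partrec {α : Type*} [Primcodable α] {o : α → ℕ → Part ℕ} (ho : Partrec₂ o)
    (c : OracleCode) : Partrec₂ fun a n => c.evalPart (o a) n := by
  induction c with
  | zero => exact (Computable.const 0 : Computable fun _ : α × ℕ => 0)
  | succ => exact (Computable.succ.comp Computable.snd : Computable fun p : α × ℕ => p.2 + 1)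
  | left => exact ((Computable.fst.comp Computable.unpair).comp Computable.snd :
      Computable fun p : α × ℕ => p.2.unpair.1)
  | right => exact ((Computable.snd.comp Computable.unpair).comp Computable.snd :
      Computable fun p : α × ℕ => p.2.unpair.2)
  | oracle => exact ho
  | pair f h hf hh =>
    have key : Partrec fun p : α × ℕ => (f.evalPart (o p.1) p.2).bind fun x =>
        (h.evalPart (o p.1) p.2).map fun y => Nat.pair x y := by
      refine Partrec.bind hf ?_
      refine Partrec.map (f := fun p : (α × ℕ) × ℕ => h.evalPart (o p.1.1) p.1.2)
        (g := fun (p : (α × ℕ) × ℕ) y => Nat.pair p.2 y) (Partrec.comp hh Computable.fst) ?_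
      exact (Primrec₂.natPair.to_comp.comp (Computable.snd.comp Computable.fst) Computable.snd)
    refine key.of_eq fun p => ?_
    simp [evalPart, Seq.seq, Part.bind_map]
  | comp f h hf hh =>
    have key : Partrec fun p : α × ℕ => (h.evalPart (o p.1) p.2).bind fun x =>
        f.evalPart (o p.1) x := by
      refine Partrec.bind hh ?_
      exact Partrec₂.comp hf (Computable.fst.comp Computable.fst) Computable.snd
    exact key
  | prec f h hf hh =>
    have key : Partrec fun p : α × ℕ => (p.2.unpair.2.rec (f.evalPart (o p.1) p.2.unpair.1)
        fun y IH => IH.bind fun i =>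
          h.evalPart (o p.1) (Nat.pair p.2.unpair.1 (Nat.pair y i)) : Part ℕ) := by
      have h1 : Computable fun p : α × ℕ => p.2.unpair.1 :=
        (Computable.fst.comp Computable.unpair).comp Computable.snd
      have h2 : Computable fun p : α × ℕ => p.2.unpair.2 :=
        (Computable.snd.comp Computable.unpair).comp Computable.snd
      refine Partrec.nat_rec (h := fun (p : α × ℕ) (z : ℕ × ℕ) =>
        h.evalPart (o p.1) (Nat.pair p.2.unpair.1 (Nat.pair z.1 z.2))) h2
        (Partrec₂.comp hf Computable.fst h1) ?_
      refine Partrec₂.comp hh (Computable.fst.comp Computable.fst) ?_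
      exact Primrec₂.natPair.to_comp.comp (h1.comp Computable.fst)
        (Primrec₂.natPair.to_comp.comp (Computable.fst.comp Computable.snd)
          (Computable.snd.comp Computable.snd))
    exact key
  | rfind f hf =>
    refine Partrec.rfind (p := fun (p : α × ℕ) n =>
      (f.evalPart (o p.1) (Nat.pair p.2 n)).map fun m => decide (m = 0)) ?_
    refine Partrec.map (f := fun p : (α × ℕ) × ℕ => f.evalPart (o p.1.1) (Nat.pair p.1.2 p.2))
      (g := fun (p : (α × ℕ) × ℕ) m => decide (m = 0)) ?_ ?_
    · exact Partrec₂.comp hf (Computable.fst.comp Computable.fst)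
        (Primrec₂.natPair.to_comp.comp (Computable.snd.comp Computable.fst) Computable.snd)
    · exact (Primrec.eq.comp Primrec.snd (Primrec.const 0)).decide.to_comp

/-! ### Programs for functionals -/

/-- Oracle programs compute every partial recursive function, ignoring the oracle. -/
theorem exists_of_partrec {f : ℕ →. ℕ} (hf : Nat.Partrec f) :
    ∃ c : OracleCode, ∀ o, c.eval o = f := by
  induction hf with
  | zero => exact ⟨.zero, fun _ => rfl⟩
  | succ => exact ⟨.succ, fun _ => rfl⟩
  | left => exact ⟨.left, fun _ => rfl⟩
  | right => exact ⟨.right, fun _ => rfl⟩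
  | pair _ _ hf hg =>
    obtain ⟨c, hc⟩ := hf
    obtain ⟨d, hd⟩ := hg
    exact ⟨.pair c d, fun o => by simp only [eval, hc, hd]; rfl⟩
  | comp _ _ hf hg =>
    obtain ⟨c, hc⟩ := hf
    obtain ⟨d, hd⟩ := hg
    exact ⟨.comp c d, fun o => by simp only [eval, hc, hd]; rfl⟩
  | prec _ _ hf hg =>
    obtain ⟨c, hc⟩ := hf
    obtain ⟨d, hd⟩ := hg
    exact ⟨.prec c d, fun o => by simp only [eval, hc, hd]; rfl⟩
  | rfind _ hf =>
    obtain ⟨c, hc⟩ := hf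
    exact ⟨.rfind c, fun o => by simp only [eval, hc]; rfl⟩

/-- One oracle program computes the codes of the initial segments of its oracle. The segments are
reversed, because consing a new value is then a single recursion step. -/
theorem exists_initSeg :
    ∃ c : OracleCode, ∀ o : ℕ → ℕ, ∀ n,
      Encodable.encode (initSeg o n).reverse ∈ c.evalPart (fun n => Part.some (o n)) n := by
  refine ⟨.comp (.prec .zero (.comp .succ (.pair (.comp .oracle (.comp .left .right))
    (.comp .right .right)))) (.pair .zero (.pair .left .right)), fun o n => ?_⟩
  refine mem_evalPart_comp.2 ⟨Nat.pair 0 n, mem_evalPart_pair.2 ⟨0, Part.mem_some _, n,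
    mem_evalPart_pair.2 ⟨_, Part.mem_some _, _, Part.mem_some _, Nat.pair_unpair n⟩, rfl⟩, ?_⟩
  induction n with
  | zero => rw [evalPart_prec_zero]; exact Part.mem_some _
  | succ n ih =>
    refine mem_evalPart_prec_succ.2 ⟨_, ih, mem_evalPart_comp.2 ⟨_, mem_evalPart_pair.2
      ⟨o n, mem_evalPart_comp.2 ⟨n, mem_evalPart_comp.2 ⟨_, Part.mem_some _, ?_⟩, Part.mem_some _⟩,
        _, mem_evalPart_comp.2 ⟨_, Part.mem_some _, Part.mem_some _⟩, rfl⟩, ?_⟩⟩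
    · simp [evalPart]
    · simp [evalPart, initSeg_succ]

end OracleCode

/-- A functional is computable if some primitive recursive `g` computes each of its values from a
long enough initial segment of the argument and answers `none` on the shorter ones. -/
theorem computableFunctional_of_primrec {F : (ℕ → ℕ) →. (ℕ → ℕ)} {g : List ℕ → ℕ → Option ℕ}
    (hg : Primrec₂ g)
    (hF : ∀ p, ∀ y ∈ F p, ∀ n, (∃ m, (g (initSeg p m) n).isSome) ∧
      ∀ m, ∀ b ∈ g (initSeg p m) n, b = y n) :
    ComputableFunctional F := by
  have hdec : Primrec fun k : ℕ =>
      g (Denumerable.ofNat (List ℕ) k.unpair.1).reverse k.unpair.2 :=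
    hg.comp (Primrec.list_reverse.comp ((Primrec.ofNat _).comp (Primrec.fst.comp Primrec.unpair)))
      (Primrec.snd.comp Primrec.unpair)
  have hV : Primrec fun k : ℕ =>
      (g (Denumerable.ofNat (List ℕ) k.unpair.1).reverse k.unpair.2).getD 0 :=
    Primrec.option_getD.comp hdec (Primrec.const 0)
  have hT : Primrec fun k : ℕ =>
      cond (g (Denumerable.ofNat (List ℕ) k.unpair.1).reverse k.unpair.2).isSome 0 1 :=
    Primrec.cond (Primrec.option_isSome.comp hdec) (Primrec.const 0) (Primrec.const 1)
  obtain ⟨V, hV⟩ := OracleCode.exists_of_partrec (Partrec.nat_iff.1 hV.to_comp.partrec)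
  obtain ⟨T, hT⟩ := OracleCode.exists_of_partrec (Partrec.nat_iff.1 hT.to_comp.partrec)
  obtain ⟨P, hP⟩ := OracleCode.exists_initSeg
  refine ⟨.comp V (.pair (.comp P (.rfind (.comp T (.pair (.comp P .right) .left))))
    (.pair .left .right)), fun p y hy n => ?_⟩
  obtain ⟨hex, hval⟩ := hF p y hy n
  replace hV := hV p
  replace hT := hT p
  replace hP := hP p
  rw [OracleCode.eval_eq_evalPart] at hV hT ⊢
  -- the value of the test program `T` for the candidate length `m`
  have htest : ∀ m, cond (g (initSeg p m) n).isSome 0 1 ∈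
      (OracleCode.comp T (.pair (.comp P .right) .left)).evalPart
        (fun n => Part.some (p n)) (Nat.pair n m) := by
    intro m
    refine OracleCode.mem_evalPart_comp.2 ⟨_, OracleCode.mem_evalPart_pair.2
      ⟨_, OracleCode.mem_evalPart_comp.2 ⟨m, ?_, hP m⟩, n, ?_, rfl⟩, ?_⟩
    · simp [OracleCode.evalPart]
    · simp [OracleCode.evalPart]
    · simp [hT]
  classical
  obtain ⟨b, hb⟩ := Option.isSome_iff_exists.1 (Nat.find_spec hex)
  refine OracleCode.mem_evalPart_comp.2 ⟨_, OracleCode.mem_evalPart_pair.2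
    ⟨_, OracleCode.mem_evalPart_comp.2 ⟨Nat.find hex,
      OracleCode.mem_evalPart_rfind.2 ⟨?_, fun m hm => ⟨_, htest m, ?_⟩⟩, hP _⟩, n,
      OracleCode.mem_evalPart_pair.2 ⟨_, Part.mem_some _, _, Part.mem_some _, Nat.pair_unpair n⟩,
      rfl⟩, ?_⟩
  · simpa [hb] using htest (Nat.find hex)
  · have := Nat.find_min hex hm
    simp_all
  · simp [hV, hb, hval _ _ hb]

/-! ### Indices of c.e. open sets -/

/-- The finite part `⟨u, Q⟩` of an oracle `⟨x, q⟩`, undefined where `u` and `Q` are. -/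
def listOracle (u : List Bool) (Q : List ℕ) (n : ℕ) : Part ℕ :=
  ((bif n % 2 == 0 then u[n / 2]?.map Bool.toNat else Q[n / 2]? : Option ℕ) : Part ℕ)

theorem listOracle_partrec : Partrec₂ fun (a : List Bool × List ℕ) n => listOracle a.1 a.2 n := by
  have h2 : Primrec fun z : (List Bool × List ℕ) × ℕ => z.2 / 2 :=
    Primrec.nat_div.comp Primrec.snd (Primrec.const 2)
  refine (Primrec.to_comp ?_).ofOption
  refine Primrec.cond (Primrec.beq.comp (Primrec.nat_mod.comp Primrec.snd (Primrec.const 2))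
    (Primrec.const 0)) (Primrec.option_map (Primrec.list_getElem?.comp
      (Primrec.fst.comp Primrec.fst) h2) ?_)
      (Primrec.list_getElem?.comp (Primrec.snd.comp Primrec.fst) h2)
  exact (Primrec.dom_bool _).comp Primrec.snd

theorem mem_listOracle {x : Cantor} {q : ℕ → ℕ} {m m' n b : ℕ} :
    b ∈ listOracle (initSeg x m') (initSeg q m) n ↔
      (if n % 2 = 0 then n / 2 < m' else n / 2 < m) ∧ interleave x.toBaire q n = b := by
  rw [listOracle, Part.mem_coe, getElem?_initSeg, getElem?_initSeg, interleave]
  by_cases h : n % 2 = 0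
  · simp [h, Cantor.toBaire]
  · rw [beq_false_of_ne h, cond_false, if_neg h, if_neg h]
    simp

/-- Every c.e. open set `U` has an index `d`, a program without oracle: it halts on finite parts
of `⟨x, q⟩` only if `x ∈ U`, and if `x ∈ U` it halts on arbitrarily long finite parts. -/
theorem exists_index (c : OracleCode) : ∃ d : Nat.Partrec.Code, ∀ q x : Cantor,
    (∀ m' m r, (d.evaln r (Encodable.encode (initSeg x m', initSeg q.toBaire m))).isSome →
      x ∈ ceOpen q c) ∧
    (x ∈ ceOpen q c → ∀ l, ∃ m' ≥ l, ∃ m r,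
      (d.evaln r (Encodable.encode (initSeg x m', initSeg q.toBaire m))).isSome) := by
  have hp : Partrec fun a : List Bool × List ℕ => c.evalPart (listOracle a.1 a.2) 0 :=
    (OracleCode.evalPart_partrec listOracle_partrec c).comp Computable.id (Computable.const 0)
  obtain ⟨d, hd⟩ := Nat.Partrec.Code.exists_code.1 hp
  have hd' : ∀ u Q b, b ∈ d.eval (Encodable.encode (u, Q)) ↔
      b ∈ c.evalPart (listOracle u Q) 0 := by
    intro u Q b
    have := congrFun hd (Encodable.encode (u, Q))
    simp only [Encodable.encodek, Part.coe_some, Part.bind_some] at this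
    rw [this, Part.mem_map_iff]
    simp
  refine ⟨d, fun q x => ⟨fun m' m r h => ?_, fun hx l => ?_⟩⟩
  · obtain ⟨b, hb⟩ := Option.isSome_iff_exists.1 h
    have hb := (hd' _ _ _).1 (Nat.Partrec.Code.evaln_sound hb)
    have : b ∈ c.eval (interleave x.toBaire q.toBaire) 0 := OracleCode.mem_eval.2
      (OracleCode.evalPart_mono (fun n b hn => Part.mem_some_iff.2 (mem_listOracle.1 hn).2.symm)
        _ _ _ hb)
    exact Part.dom_iff_mem.2 ⟨b, this⟩
  · obtain ⟨b, hb⟩ := Part.dom_iff_mem.1 hx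
    obtain ⟨N, hN⟩ := OracleCode.exists_restrict c _ _ (OracleCode.mem_eval.1 hb)
    have : b ∈ c.evalPart (listOracle (initSeg x (max N l)) (initSeg q.toBaire N)) 0 := by
      refine OracleCode.evalPart_mono (fun n b hn => ?_) _ _ _ hN
      obtain ⟨hn, rfl⟩ := OracleCode.mem_restrict.1 hn
      refine mem_listOracle.2 ⟨?_, rfl⟩
      have := Nat.div_le_self n 2
      split_ifs
      · exact lt_max_of_lt_left (by omega)
      · omega
    obtain ⟨r, hr⟩ := Nat.Partrec.Code.evaln_complete.1 ((hd' _ _ _).2 this)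
    exact ⟨_, le_max_right _ _, N, r, Option.isSome_iff_exists.2 ⟨b, hr⟩⟩

/-- The `s`-th attempt at finding an extension `u` of `w` such that program number `i` halts on `u`
together with some initial segment of `q`. The number `s` codes the word to be appended to `w`, the
length of the segment of `q`, and the number of computation steps. -/
def extension (q : ℕ → ℕ) (i : ℕ) (w : List Bool) (s : ℕ) : Option (List Bool) :=
  bif ((Denumerable.ofNat Nat.Partrec.Code i).evaln s.unpair.2.unpair.2 (Encodable.encode
      (w ++ (Encodable.decode s.unpair.1).getD [], initSeg q s.unpair.2.unpair.1))).isSome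
  then some (w ++ (Encodable.decode s.unpair.1).getD []) else none

theorem extension_eq_some {q : ℕ → ℕ} {i s : ℕ} {w u : List Bool} :
    extension q i w s = some u ↔
      u = w ++ (Encodable.decode s.unpair.1).getD [] ∧
        ((Denumerable.ofNat Nat.Partrec.Code i).evaln s.unpair.2.unpair.2
          (Encodable.encode (u, initSeg q s.unpair.2.unpair.1))).isSome := by
  rw [extension, cond_eq_ite]
  split_ifs with h
  · constructor
    · intro h'
      obtain rfl := Option.some.inj h'
      exact ⟨rfl, h⟩
    · rintro ⟨rfl, -⟩
      rfl
  · constructor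
    · intro h'
      exact absurd h' (by simp)
    · rintro ⟨rfl, h'⟩
      exact absurd h' h

theorem extension_isPrefix {q : ℕ → ℕ} {i s : ℕ} {w u : List Bool}
    (h : extension q i w s = some u) : w <+: u :=
  (extension_eq_some.1 h).1 ▸ List.prefix_append _ _

theorem extension_congr {q q' : ℕ → ℕ} {N : ℕ} (h : ∀ j < N, q j = q' j) (i : ℕ) (w : List Bool)
    {s : ℕ} (hs : s < N) : extension q i w s = extension q' i w s := by
  have : initSeg q s.unpair.2.unpair.1 = initSeg q' s.unpair.2.unpair.1 :=
    initSeg_congr fun j hj => h j (hj.trans_le ((Nat.unpair_left_le _).trans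
      ((Nat.unpair_right_le _).trans hs.le)))
  rw [extension, extension, this]

/-- Every c.e. open set has an index such that all words found by `extension` lie in the set, and
all prefixes of its points have an extension that is found. -/
theorem exists_extension_index (c : OracleCode) : ∃ i, ∀ q x : Cantor,
    (∀ w s u n, extension q.toBaire i w s = some u → u = initSeg x n → x ∈ ceOpen q c) ∧
    (x ∈ ceOpen q c → ∀ n, ∃ s, extension q.toBaire i (initSeg x n) s ≠ none) := by
  obtain ⟨d, hd⟩ := exists_index c
  refine ⟨Encodable.encode d, fun q x => ⟨fun w s u n h hu => ?_, fun hx n => ?_⟩⟩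
  · subst hu
    rw [extension_eq_some, Denumerable.ofNat_encode] at h
    exact (hd q x).1 _ _ _ h.2
  · obtain ⟨m', hm', m, r, h⟩ := (hd q x).2 hx n
    obtain ⟨v, hv⟩ := initSeg_isPrefix x hm'
    refine ⟨Nat.pair (Encodable.encode v) (Nat.pair m r), ?_⟩
    rw [Option.ne_none_iff_exists']
    refine ⟨initSeg x m', extension_eq_some.2 ?_⟩
    rw [Nat.unpair_pair, Nat.unpair_pair, Encodable.encodek, Denumerable.ofNat_encode]
    exact ⟨hv.symm, h⟩

theorem initSeg_primrec {α σ : Type*} [Primcodable α] [Primcodable σ] {f : α → ℕ → σ}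
    (hf : Primrec₂ f) : Primrec₂ fun a n => initSeg (f a) n :=
  Primrec.list_map (Primrec.list_range.comp Primrec.snd)
    (hf.comp (Primrec.fst.comp Primrec.fst) Primrec.snd)

theorem extension_primrec {α : Type*} [Primcodable α] {q : α → ℕ → ℕ} (hq : Primrec₂ q) :
    Primrec fun z : α × ℕ × List Bool × ℕ => extension (q z.1) z.2.1 z.2.2.1 z.2.2.2 := by
  have hs : Primrec fun z : α × ℕ × List Bool × ℕ => z.2.2.2 :=
    Primrec.snd.comp (Primrec.snd.comp Primrec.snd)
  have hw : Primrec fun z : α × ℕ × List Bool × ℕ => z.2.2.1 :=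
    Primrec.fst.comp (Primrec.snd.comp Primrec.snd)
  have h2 : Primrec fun z : α × ℕ × List Bool × ℕ => z.2.2.2.unpair.2.unpair :=
    Primrec.unpair.comp (Primrec.snd.comp (Primrec.unpair.comp hs))
  have hv : Primrec fun z : α × ℕ × List Bool × ℕ =>
      z.2.2.1 ++ (Encodable.decode (α := List Bool) z.2.2.2.unpair.1).getD [] :=
    Primrec.list_append.comp hw (Primrec.option_getD.comp
      (Primrec.decode.comp (Primrec.fst.comp (Primrec.unpair.comp hs))) (Primrec.const []))
  have hQ : Primrec fun z : α × ℕ × List Bool × ℕ =>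
      initSeg (q z.1) z.2.2.2.unpair.2.unpair.1 :=
    (initSeg_primrec hq).comp Primrec.fst (Primrec.fst.comp h2)
  have hi : Primrec fun z : α × ℕ × List Bool × ℕ =>
      Denumerable.ofNat Nat.Partrec.Code z.2.1 :=
    (Primrec.ofNat _).comp (Primrec.fst.comp Primrec.snd)
  exact Primrec.cond (Primrec.option_isSome.comp (Nat.Partrec.Code.primrec_evaln.comp
    (Primrec.pair (Primrec.pair (Primrec.snd.comp h2) hi) (Primrec.encode.comp
      (Primrec.pair hv hQ))))) (Primrec.option_some.comp hv) (Primrec.const none)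

/-! ### Bounded search -/

/-- The first value of `f` below `s` that is not `none`, if there is one. -/
def search {β : Type*} (f : ℕ → Option β) : ℕ → Option β
  | 0 => none
  | s + 1 => search f s <|> f s

section search
variable {β : Type*} {f g : ℕ → Option β}

theorem search_mono {s s' : ℕ} (h : s ≤ s') {b : β} (hb : search f s = some b) :
    search f s' = some b := by
  induction s', h using Nat.le_induction with
  | base => exact hb
  | succ n _ ih => simp [search, ih]

theorem exists_of_search {s : ℕ} {b : β} (hb : search f s = some b) : ∃ n < s, f n = some b := by
  induction s with
  | zero => simp [search] at hb
  | succ s ih =>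
    cases h : search f s with
    | none => exact ⟨s, s.lt_succ_self, by simpa [search, h] using hb⟩
    | some a =>
      obtain ⟨n, hn, e⟩ := ih (by simpa [search, h] using hb)
      exact ⟨n, hn.trans s.lt_succ_self, e⟩

theorem search_eq_none {s : ℕ} : search f s = none ↔ ∀ n < s, f n = none := by
  refine ⟨fun h => ?_, fun h => ?_⟩
  · induction s with
    | zero => simp
    | succ s ih =>
      replace h : search f s = none ∧ f s = none := by simpa [search] using h
      intro n hn
      rcases Nat.lt_succ_iff_lt_or_eq.1 hn with hn | rfl
      · exact ih h.1 n hn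
      · exact h.2
  · by_contra hne
    obtain ⟨b, hb⟩ := Option.ne_none_iff_exists'.1 hne
    obtain ⟨n, hn, e⟩ := exists_of_search hb
    simp [h n hn] at e

theorem search_congr {s : ℕ} (h : ∀ n < s, f n = g n) : search f s = search g s := by
  induction s with
  | zero => rfl
  | succ s ih => rw [search, search, ih fun n hn => h n (hn.trans s.lt_succ_self), h s s.lt_succ_self]

theorem search_primrec {α β : Type*} [Primcodable α] [Primcodable β] {f : α → ℕ → Option β}
    (hf : Primrec₂ f) : Primrec₂ fun a s => search (f a) s := by
  have : Primrec₂ fun (a : α) (s : ℕ) =>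
      (Nat.rec none (fun n b => b <|> f a n) s : Option β) :=
    Primrec.nat_rec (Primrec.const none) (Primrec.to₂ (Primrec.option_orElse.comp
      (Primrec.snd.comp Primrec.snd) (hf.comp Primrec.fst (Primrec.fst.comp Primrec.snd))))
  refine this.of_eq fun a s => ?_
  induction s with
  | zero => rfl
  | succ s ih => simp only [search, ← ih]

end search

/-! ### The fireworks process -/

/-- A state of the fireworks process: the word produced so far, and the log of all refuted
conjectures. An entry `(i, w)` says that a conjecture of requirement `i` was refuted when the word
was `w`. -/
abbrev State : Type := List Bool × List (ℕ × List Bool)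

/-- The words at which conjectures of requirement `i` were refuted, the latest one first. -/
def history (i : ℕ) (L : List (ℕ × List Bool)) : List (List Bool) :=
  L.filterMap fun e => bif e.1 == i then some e.2 else none

@[simp] theorem history_cons_self (i : ℕ) (w : List Bool) (L : List (ℕ × List Bool)) :
    history i ((i, w) :: L) = w :: history i L := by
  simp [history]

theorem history_cons_of_ne {i j : ℕ} (h : j ≠ i) (w : List Bool) (L : List (ℕ × List Bool)) :
    history i ((j, w) :: L) = history i L := by
  rw [history, List.filterMap_cons]
  simp only [beq_false_of_ne h, cond_false]
  rfl

theorem mem_history {i : ℕ} {w : List Bool} {L : List (ℕ × List Bool)} :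
    w ∈ history i L ↔ (i, w) ∈ L := by
  simp only [history, List.mem_filterMap, cond_eq_ite]
  constructor
  · rintro ⟨⟨j, v⟩, he, h⟩
    simp at h
    rwa [← h.1, ← h.2]
  · exact fun h => ⟨_, h, by simp⟩

section process

variable (ext : ℕ → List Bool → ℕ → Option (List Bool)) (k : ℕ → ℕ)

/-- At stage `t`, requirement `i = t.unpair.1` has been found to be wrong about its current
conjecture, which is that its most recently logged word (initially the empty word) has no suitable
extension. -/
def Refuted (t : ℕ) (S : State) : Prop :=
  (search (ext t.unpair.1 (history t.unpair.1 S.2).headI) t).isSome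

instance (t : ℕ) (S : State) : Decidable (Refuted ext t S) :=
  inferInstanceAs (Decidable (_ = true))

/-- Stage `t` of the fireworks process, which belongs to requirement `i = t.unpair.1`. The word
always grows, so that it is infinite in the limit. If the current conjecture of `i` is refuted and
it is conjecture number `k i`, then an extension of the current word is awaited, where `s` bounds
the search; the result is `none` if the search fails. Otherwise `i` conjectures that the current
word has no extension. -/
def step (s t : ℕ) (S : State) : Option State :=
  if Refuted ext t S then
    if (history t.unpair.1 S.2).length = k t.unpair.1 then
      (search (ext t.unpair.1 S.1) s).map fun u => (u ++ [false], (t.unpair.1, S.1) :: S.2)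
    else some (S.1 ++ [false], (t.unpair.1, S.1) :: S.2)
  else some (S.1 ++ [false], S.2)

/-- The state of the fireworks process after `t` stages, with search bound `s`. -/
def run (s : ℕ) : ℕ → Option State
  | 0 => some ([], [])
  | t + 1 => (run s t).bind (step ext k s t)

/-- The fireworks process with unbounded search reaches the state `S` after `t` stages. -/
def Reaches (t : ℕ) (S : State) : Prop := ∃ s, run ext k s t = some S

/-- At some stage requirement `i` awaits an extension that does not exist. -/
def Stuck (i : ℕ) : Prop :=
  ∃ t S, t.unpair.1 = i ∧ Reaches ext k t S ∧ Refuted ext t S ∧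
    (history i S.2).length = k i ∧ ∀ s, ext i S.1 s = none

variable {ext k}

theorem step_mono {s s' t : ℕ} (h : s ≤ s') {S S' : State} (hS : step ext k s t S = some S') :
    step ext k s' t S = some S' := by
  unfold step at hS ⊢
  split_ifs at hS ⊢
  · obtain ⟨u, hu, rfl⟩ := Option.map_eq_some_iff.1 hS
    rw [search_mono h hu]
    rfl
  · exact hS
  · exact hS

theorem run_mono {s s' : ℕ} (h : s ≤ s') :
    ∀ {t : ℕ} {S : State}, run ext k s t = some S → run ext k s' t = some S
  | 0, _, hS => hS
  | t + 1, S, hS => by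
    obtain ⟨S₀, h₀, h₁⟩ := Option.bind_eq_some_iff.1 hS
    exact Option.bind_eq_some_iff.2 ⟨S₀, run_mono h h₀, step_mono h h₁⟩

theorem Reaches.unique {t : ℕ} {S S' : State} (h : Reaches ext k t S) (h' : Reaches ext k t S') :
    S = S' := by
  obtain ⟨s, hs⟩ := h
  obtain ⟨s', hs'⟩ := h'
  exact Option.some.inj ((run_mono (le_max_left s s') hs).symm.trans
    (run_mono (le_max_right s s') hs'))

theorem reaches_zero : Reaches ext k 0 ([], []) := ⟨0, rfl⟩

theorem reaches_succ {t : ℕ} {S' : State} :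
    Reaches ext k (t + 1) S' ↔ ∃ S, Reaches ext k t S ∧ ∃ s, step ext k s t S = some S' := by
  constructor
  · rintro ⟨s, hs⟩
    obtain ⟨S, h, h'⟩ := Option.bind_eq_some_iff.1 hs
    exact ⟨S, ⟨s, h⟩, s, h'⟩
  · rintro ⟨S, ⟨s, h⟩, s', h'⟩
    exact ⟨max s s', Option.bind_eq_some_iff.2 ⟨S, run_mono (le_max_left _ _) h,
      step_mono (le_max_right _ _) h'⟩⟩

/-- If no requirement ever gets stuck, then the process runs forever. -/
theorem exists_reaches (h : ∀ i, ¬ Stuck ext k i) : ∀ t, ∃ S, Reaches ext k t S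
  | 0 => ⟨_, reaches_zero⟩
  | t + 1 => by
    obtain ⟨S, hS⟩ := exists_reaches h t
    by_cases hR : Refuted ext t S
    · by_cases hk : (history t.unpair.1 S.2).length = k t.unpair.1
      · have : ∃ s, ext t.unpair.1 S.1 s ≠ none := by
          by_contra hn
          push Not at hn
          exact h _ ⟨t, S, rfl, hS, hR, hk, hn⟩
        obtain ⟨s, hs⟩ := this
        have hs' : search (ext t.unpair.1 S.1) (s + 1) ≠ none := fun e =>
          hs (search_eq_none.1 e s s.lt_succ_self)
        obtain ⟨u, hu⟩ := Option.ne_none_iff_exists'.1 hs'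
        refine ⟨(u ++ [false], (t.unpair.1, S.1) :: S.2), reaches_succ.2 ⟨S, hS, s + 1, ?_⟩⟩
        rw [step, if_pos hR, if_pos hk, hu]
        rfl
      · exact ⟨_, reaches_succ.2 ⟨S, hS, 0, by rw [step, if_pos hR, if_neg hk]⟩⟩
    · exact ⟨_, reaches_succ.2 ⟨S, hS, 0, by rw [step, if_neg hR]⟩⟩

/-- How one stage changes the log. -/
theorem step_snd {s t : ℕ} {S S' : State} (h : step ext k s t S = some S') :
    S'.2 = if Refuted ext t S then (t.unpair.1, S.1) :: S.2 else S.2 := by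
  unfold step at h
  split_ifs at h ⊢
  · obtain ⟨u, hu, rfl⟩ := Option.map_eq_some_iff.1 h
    rfl
  all_goals rw [← Option.some.inj h]

theorem step_history_self {s t : ℕ} {S S' : State} (h : step ext k s t S = some S')
    (hR : Refuted ext t S) : history t.unpair.1 S'.2 = S.1 :: history t.unpair.1 S.2 := by
  rw [step_snd h, if_pos hR, history_cons_self]

theorem step_history_of_not {s t i : ℕ} {S S' : State} (h : step ext k s t S = some S')
    (hR : ¬ (t.unpair.1 = i ∧ Refuted ext t S)) : history i S'.2 = history i S.2 := by
  rw [step_snd h]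
  split_ifs with hR'
  · exact history_cons_of_ne (fun e => hR ⟨e, hR'⟩) _ _
  · rfl

theorem step_history_length_le {s t : ℕ} (i : ℕ) {S S' : State} (h : step ext k s t S = some S') :
    (history i S.2).length ≤ (history i S'.2).length := by
  by_cases hR : t.unpair.1 = i ∧ Refuted ext t S
  · obtain ⟨rfl, hR⟩ := hR
    rw [step_history_self h hR]
    simp
  · rw [step_history_of_not h hR]

theorem Reaches.history_length_mono {t t' : ℕ} (htt : t ≤ t') (i : ℕ) {S S' : State}
    (h : Reaches ext k t S) (h' : Reaches ext k t' S') :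
    (history i S.2).length ≤ (history i S'.2).length := by
  induction t', htt using Nat.le_induction generalizing S' with
  | base => rw [h.unique h']
  | succ n _ ih =>
    obtain ⟨S₁, h₁, s, hs⟩ := reaches_succ.1 h'
    exact (ih h₁).trans (step_history_length_le i hs)

/-- Changing the threshold of requirement `i` has no effect as long as neither of the two
thresholds has been reached. -/
theorem Reaches.of_lt {k' : ℕ → ℕ} {i : ℕ} (hk : ∀ j ≠ i, k j = k' j) (hlt : k i < k' i) :
    ∀ {t : ℕ} {S : State}, Reaches ext k t S → (history i S.2).length ≤ k i → Reaches ext k' t S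
  | 0, S, h, _ => by
    rw [h.unique reaches_zero]
    exact reaches_zero
  | t + 1, S', h, hle => by
    obtain ⟨S, hS, s, hs⟩ := reaches_succ.1 h
    have hS' := hS.of_lt hk hlt ((step_history_length_le i hs).trans hle)
    refine reaches_succ.2 ⟨S, hS', s, ?_⟩
    by_cases hR : Refuted ext t S
    · rw [step, if_pos hR] at hs ⊢
      by_cases hi : t.unpair.1 = i
      · subst hi
        have h1 := step_history_self (k := k) (s := s) (S := S) (S' := S') (t := t)
          (by rw [step, if_pos hR]; exact hs) hR
        rw [h1, List.length_cons] at hle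
        rw [if_neg (by omega)] at hs ⊢
        exact hs
      · rwa [← hk _ hi]
    · rw [step, if_neg hR] at hs ⊢
      exact hs

/-- The fireworks argument: if the thresholds of all other requirements are fixed, then there is
at most one threshold for which requirement `i` gets stuck. With any larger threshold, `i` would
correctly conjecture at the same place that there is no extension, and never act again. -/
theorem Stuck.not_threshold_lt {k' : ℕ → ℕ} {i : ℕ} (hk : ∀ j ≠ i, k j = k' j) (h : Stuck ext k i)
    (h' : Stuck ext k' i) : ¬ k i < k' i := by
  intro hlt
  obtain ⟨t, S, hti, hS, hR, hc, hn⟩ := h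
  obtain ⟨t', S', hti', hS', hR', hc', hn'⟩ := h'
  have hS₁ := hS.of_lt hk hlt hc.le
  have htt : t < t' := by
    by_contra hle
    have := hS'.history_length_mono (not_lt.1 hle) i hS₁
    omega
  -- from stage `t + 1` on, the conjecture of `i` is about `S.1`, and it is never refuted
  have key : ∀ t'', t + 1 ≤ t'' → ∀ S'', Reaches ext k' t'' S'' →
      (history i S''.2).headI = S.1 := by
    intro t'' ht''
    induction t'', ht'' using Nat.le_induction with
    | base =>
      intro S'' h''
      obtain ⟨S₂, h₂, s, hs⟩ := reaches_succ.1 h''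
      rw [h₂.unique hS₁] at hs
      subst hti
      rw [step_history_self hs hR, List.headI_cons]
    | succ n _ ih =>
      intro S'' h''
      obtain ⟨S₂, h₂, s, hs⟩ := reaches_succ.1 h''
      rw [step_history_of_not hs, ih _ h₂]
      rintro ⟨rfl, hR₂⟩
      rw [Refuted, ih _ h₂, search_eq_none.2 fun s _ => hn s] at hR₂
      simp at hR₂
  subst hti'
  rw [Refuted, key t' htt _ hS', search_eq_none.2 fun s _ => hn s] at hR'
  simp at hR'

theorem Stuck.unique {k' : ℕ → ℕ} {i : ℕ} (hk : ∀ j ≠ i, k j = k' j) (h : Stuck ext k i)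
    (h' : Stuck ext k' i) : k i = k' i :=
  le_antisymm (not_lt.1 (h'.not_threshold_lt (fun j hj => (hk j hj).symm) h)) (not_lt.1 (h.not_threshold_lt hk h'))

theorem step_fst (hext : ∀ i w s u, ext i w s = some u → w <+: u) {s t : ℕ} {S S' : State}
    (h : step ext k s t S = some S') : ∃ v, S.1 <+: v ∧ S'.1 = v ++ [false] := by
  unfold step at h
  split_ifs at h
  · obtain ⟨u, hu, rfl⟩ := Option.map_eq_some_iff.1 h
    obtain ⟨n, -, hn⟩ := exists_of_search hu
    exact ⟨u, hext _ _ _ _ hn, rfl⟩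
  all_goals exact ⟨S.1, List.prefix_rfl, by rw [← Option.some.inj h]⟩

theorem Reaches.isPrefix (hext : ∀ i w s u, ext i w s = some u → w <+: u) {t t' : ℕ} (htt : t ≤ t')
    {S S' : State} (h : Reaches ext k t S) (h' : Reaches ext k t' S') : S.1 <+: S'.1 := by
  induction t', htt using Nat.le_induction generalizing S' with
  | base => rw [h.unique h']
  | succ n _ ih =>
    obtain ⟨S₁, h₁, s, hs⟩ := reaches_succ.1 h'
    obtain ⟨v, hv, e⟩ := step_fst hext hs
    rw [e]
    exact (ih h₁).trans (hv.trans (List.prefix_append _ _))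

theorem Reaches.le_length (hext : ∀ i w s u, ext i w s = some u → w <+: u) :
    ∀ {t : ℕ} {S : State}, Reaches ext k t S → t ≤ S.1.length
  | 0, _, _ => Nat.zero_le _
  | t + 1, S, h => by
    obtain ⟨S₁, h₁, s, hs⟩ := reaches_succ.1 h
    obtain ⟨v, hv, e⟩ := step_fst hext hs
    have := h₁.le_length hext
    have := hv.length_le
    rw [e, List.length_append, List.length_singleton]
    omega

/-- All logged words are prefixes of the word produced by the process. -/
theorem Reaches.log_isPrefix (hext : ∀ i w s u, ext i w s = some u → w <+: u) :
    ∀ {t : ℕ} {S : State}, Reaches ext k t S → ∀ e ∈ S.2, e.2 <+: S.1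
  | 0, S, h => by
    rw [h.unique reaches_zero]
    simp
  | t + 1, S, h => by
    obtain ⟨S₁, h₁, s, hs⟩ := reaches_succ.1 h
    have hp := h₁.isPrefix hext t.le_succ h
    rw [step_snd hs]
    intro e he
    have ih := h₁.log_isPrefix hext
    split_ifs at he
    · rcases List.mem_cons.1 he with rfl | he
      · exact hp
      · exact (ih e he).trans hp
    · exact (ih e he).trans hp

theorem Reaches.headI_history_isPrefix (hext : ∀ i w s u, ext i w s = some u → w <+: u) {t : ℕ}
    {S : State} (h : Reaches ext k t S) (i : ℕ) : (history i S.2).headI <+: S.1 := by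
  cases hh : history i S.2 with
  | nil => exact List.nil_prefix
  | cons w l =>
    exact h.log_isPrefix hext (i, w) (mem_history.1 (by rw [hh]; exact List.mem_cons_self))

/-- If the process runs forever, then each requirement is met: the word enters the open set, or
some prefix has no extension in it. -/
theorem meets_requirement (hext : ∀ i w s u, ext i w s = some u → w <+: u)
    (h : ∀ t, ∃ S, Reaches ext k t S) (i : ℕ) :
    (∃ t S w s u, Reaches ext k t S ∧ ext i w s = some u ∧ u <+: S.1) ∨
      ∃ t S g, Reaches ext k t S ∧ g <+: S.1 ∧ ∀ s, ext i g s = none := by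
  choose S hS using h
  have hstep : ∀ t, ∃ s, step ext k s t (S t) = some (S (t + 1)) := fun t => by
    obtain ⟨S₁, h₁, hs⟩ := reaches_succ.1 (hS (t + 1))
    rwa [h₁.unique (hS t)] at hs
  have hmono : ∀ {t t'}, t ≤ t' → (history i (S t).2).length ≤ (history i (S t').2).length :=
    fun htt => (hS _).history_length_mono htt i (hS _)
  by_cases hb : ∃ t, k i < (history i (S t).2).length
  · -- the count passes the threshold, hence an extension has been awaited successfully
    left
    classical
    obtain ⟨t, ht, hmin⟩ : ∃ t, k i < (history i (S t).2).length ∧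
        ∀ m < t, ¬ k i < (history i (S m).2).length :=
      ⟨Nat.find hb, Nat.find_spec hb, fun m hm => Nat.find_min hb hm⟩
    cases t with
    | zero =>
      rw [(hS 0).unique reaches_zero] at ht
      simp [history] at ht
    | succ t =>
      have hlt := hmin t t.lt_succ_self
      obtain ⟨s, hs⟩ := hstep t
      have hR : t.unpair.1 = i ∧ Refuted ext t (S t) := by
        by_contra hR
        rw [step_history_of_not hs hR] at ht
        exact hlt ht
      obtain ⟨rfl, hR⟩ := hR
      rw [step_history_self hs hR, List.length_cons] at ht
      rw [step, if_pos hR, if_pos (by omega)] at hs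
      obtain ⟨u, hu, e⟩ := Option.map_eq_some_iff.1 hs
      obtain ⟨n, -, hn⟩ := exists_of_search hu
      exact ⟨t + 1, S (t + 1), _, n, u, hS _, hn, by rw [← e]; exact List.prefix_append _ _⟩
  · -- the count is bounded, hence the last conjecture is correct
    right
    push Not at hb
    have hbdd : BddAbove (Set.range fun t => (history i (S t).2).length) :=
      ⟨k i, by rintro _ ⟨t, rfl⟩; exact hb t⟩
    obtain ⟨t₀, ht₀⟩ := Nat.sSup_mem (Set.range_nonempty _) hbdd
    have hconst : ∀ t, t₀ ≤ t → (history i (S t).2).length = (history i (S t₀).2).length :=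
      fun t ht => le_antisymm ((le_csSup hbdd ⟨t, rfl⟩).trans ht₀.ge) (hmono ht)
    have hnot : ∀ t, t₀ ≤ t → ¬ (t.unpair.1 = i ∧ Refuted ext t (S t)) := by
      rintro t ht ⟨rfl, hR⟩
      obtain ⟨s, hs⟩ := hstep t
      have h₁ := hconst (t + 1) (by omega)
      rw [step_history_self hs hR, List.length_cons, hconst t ht] at h₁
      omega
    have hhist : ∀ t, t₀ ≤ t → history i (S t).2 = history i (S t₀).2 := by
      intro t ht
      induction t, ht using Nat.le_induction with
      | base => rfl
      | succ n hn ih =>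
        obtain ⟨s, hs⟩ := hstep n
        rw [step_history_of_not hs (hnot n hn), ih]
    refine ⟨t₀, S t₀, (history i (S t₀).2).headI, hS t₀,
      (hS t₀).headI_history_isPrefix hext i, fun s => ?_⟩
    have hle : max (s + 1) t₀ ≤ Nat.pair i (max (s + 1) t₀) := Nat.right_le_pair _ _
    have := hnot (Nat.pair i (max (s + 1) t₀)) ((le_max_right _ _).trans hle)
    rw [Refuted, Nat.unpair_pair, hhist _ ((le_max_right _ _).trans hle)] at this
    simp only [true_and, Option.not_isSome_iff_eq_none] at this
    exact search_eq_none.1 this s (by have := le_max_left (s + 1) t₀; omega)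

/-- The process with bound `s` depends, for `t` stages, only on the first `max s t` search attempts
and on the thresholds of the requirements below `t`. -/
theorem run_congr {ext' : ℕ → List Bool → ℕ → Option (List Bool)} {k' : ℕ → ℕ} {s : ℕ} :
    ∀ {t : ℕ}, (∀ i w, ∀ n < max s t, ext i w n = ext' i w n) → (∀ i < t, k i = k' i) →
      run ext k s t = run ext' k' s t
  | 0, _, _ => rfl
  | t + 1, he, hk => by
    have ih : run ext k s t = run ext' k' s t :=
      run_congr (fun i w n hn => he i w n (by omega)) fun i hi => hk i (by omega)
    rw [run, run, ih]
    congr 1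
    funext S
    have h₁ : search (ext t.unpair.1 (history t.unpair.1 S.2).headI) t =
        search (ext' t.unpair.1 (history t.unpair.1 S.2).headI) t :=
      search_congr fun n hn => he _ _ n (by omega)
    have h₂ : search (ext t.unpair.1 S.1) s = search (ext' t.unpair.1 S.1) s :=
      search_congr fun n hn => he _ _ n (by omega)
    have h₃ : k t.unpair.1 = k' t.unpair.1 := hk _ (Nat.lt_succ_of_le (Nat.unpair_left_le t))
    simp only [step, Refuted, h₁, h₂, h₃]
    congr!

end process

theorem history_primrec : Primrec₂ history :=
  Primrec.listFilterMap Primrec.snd (Primrec.cond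
    (Primrec.beq.comp (Primrec.fst.comp Primrec.snd) (Primrec.fst.comp Primrec.fst))
    (Primrec.option_some.comp (Primrec.snd.comp Primrec.snd)) (Primrec.const none))

theorem run_primrec {α : Type*} [Primcodable α] {ext : α → ℕ → List Bool → ℕ → Option (List Bool)}
    {k : α → ℕ → ℕ}
    (hext : Primrec fun z : α × ℕ × List Bool × ℕ => ext z.1 z.2.1 z.2.2.1 z.2.2.2)
    (hk : Primrec₂ k) : Primrec fun z : α × ℕ × ℕ => run (ext z.1) (k z.1) z.2.1 z.2.2 := by
  -- parameters of `step`: `z = ((a, s), t, S)`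
  have ha : Primrec fun z : (α × ℕ) × ℕ × State => z.1.1 := Primrec.fst.comp Primrec.fst
  have hs : Primrec fun z : (α × ℕ) × ℕ × State => z.1.2 := Primrec.snd.comp Primrec.fst
  have ht : Primrec fun z : (α × ℕ) × ℕ × State => z.2.1 := Primrec.fst.comp Primrec.snd
  have hi : Primrec fun z : (α × ℕ) × ℕ × State => z.2.1.unpair.1 :=
    Primrec.fst.comp (Primrec.unpair.comp ht)
  have hw : Primrec fun z : (α × ℕ) × ℕ × State => z.2.2.1 :=
    Primrec.fst.comp (Primrec.snd.comp Primrec.snd)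
  have hL : Primrec fun z : (α × ℕ) × ℕ × State => z.2.2.2 :=
    Primrec.snd.comp (Primrec.snd.comp Primrec.snd)
  have hH : Primrec fun z : (α × ℕ) × ℕ × State => history z.2.1.unpair.1 z.2.2.2 :=
    history_primrec.comp hi hL
  have hsearch : ∀ {w : (α × ℕ) × ℕ × State → List Bool} {n : (α × ℕ) × ℕ × State → ℕ},
      Primrec w → Primrec n →
      Primrec fun z => search (ext z.1.1 z.2.1.unpair.1 (w z)) (n z) := by
    intro w n hw hn
    have : Primrec₂ fun (z : (α × ℕ) × ℕ × State) m => ext z.1.1 z.2.1.unpair.1 (w z) m :=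
      hext.comp (Primrec.pair (ha.comp Primrec.fst) (Primrec.pair (hi.comp Primrec.fst)
        (Primrec.pair (hw.comp Primrec.fst) Primrec.snd)))
    exact (search_primrec this).comp Primrec.id hn
  have hR : PrimrecPred fun z : (α × ℕ) × ℕ × State => Refuted (ext z.1.1) z.2.1 z.2.2 :=
    Primrec.eq.comp (Primrec.option_isSome.comp (hsearch (Primrec.list_headI.comp hH) ht))
      (Primrec.const true)
  have hlog : Primrec fun z : (α × ℕ) × ℕ × State => (z.2.1.unpair.1, z.2.2.1) :: z.2.2.2 :=
    Primrec.list_cons.comp (Primrec.pair hi hw) hL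
  have hw' : Primrec fun z : (α × ℕ) × ℕ × State => z.2.2.1 ++ [false] :=
    Primrec.list_concat.comp hw (Primrec.const false)
  have hstep : Primrec fun z : (α × ℕ) × ℕ × State =>
      step (ext z.1.1) (k z.1.1) z.1.2 z.2.1 z.2.2 := by
    refine Primrec.ite hR (Primrec.ite (Primrec.eq.comp (Primrec.list_length.comp hH)
      (hk.comp ha hi)) (Primrec.option_map (hsearch hw hs) ?_)
      (Primrec.option_some.comp (Primrec.pair hw' hlog)))
      (Primrec.option_some.comp (Primrec.pair hw' hL))
    exact Primrec.pair (Primrec.list_concat.comp Primrec.snd (Primrec.const false))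
      (hlog.comp Primrec.fst)
  have hbind : Primrec fun z : (α × ℕ) × ℕ × Option State =>
      z.2.2.bind (step (ext z.1.1) (k z.1.1) z.1.2 z.2.1) :=
    Primrec.option_bind (Primrec.snd.comp Primrec.snd) (hstep.comp (Primrec.pair
      (Primrec.fst.comp Primrec.fst)
      (Primrec.pair (Primrec.fst.comp (Primrec.snd.comp Primrec.fst)) Primrec.snd)))
  have hrec : Primrec₂ fun (z : α × ℕ) (t : ℕ) =>
      (Nat.rec (some ([], [])) (fun t o => o.bind (step (ext z.1) (k z.1) z.2 t)) t :
        Option State) :=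
    Primrec.nat_rec (Primrec.const _) hbind.to₂
  refine (hrec.comp (Primrec.pair Primrec.fst (Primrec.fst.comp Primrec.snd))
    (Primrec.snd.comp Primrec.snd)).of_eq fun ⟨a, s, t⟩ => ?_
  induction t with
  | zero => rfl
  | succ t ih => simp only [run] at ih ⊢; rw [← ih]

/-! ### Random thresholds -/

/-- The thresholds read off from the random sequence `x` at error level `n`: that of requirement
`i` is the code of the block consisting of the first `n + i + 2` bits of the `i`-th column of `x`.
The code is used as a threshold although it is sparse: only its injectivity matters. -/
def threshold (n : ℕ) (x : ℕ → Bool) (i : ℕ) : ℕ :=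
  Encodable.encode (initSeg (fun j => x (Nat.pair i j)) (n + i + 2))

/-- A bound on the bits of the random sequence that are used by the requirements below `t`. -/
def useBound (n t : ℕ) : ℕ := Nat.pair t (n + t + 2)

theorem le_useBound (n t : ℕ) : t ≤ useBound n t := Nat.left_le_pair _ _

theorem threshold_congr {n t : ℕ} {x y : ℕ → Bool} (h : ∀ m < useBound n t, x m = y m) :
    ∀ i < t, threshold n x i = threshold n y i := by
  intro i hi
  rw [threshold, threshold, initSeg_congr fun j hj => h _ ?_]
  exact (Nat.pair_lt_pair_left _ hi).trans (Nat.pair_lt_pair_right _ (by omega))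

theorem threshold_primrec {α : Type*} [Primcodable α] {n : α → ℕ} {x : α → ℕ → Bool}
    (hn : Primrec n) (hx : Primrec₂ x) : Primrec₂ fun a i => threshold (n a) (x a) i := by
  have : Primrec₂ fun (z : α × ℕ) j => x z.1 (Nat.pair z.2 j) :=
    hx.comp (Primrec.fst.comp Primrec.fst)
      (Primrec₂.natPair.comp (Primrec.snd.comp Primrec.fst) Primrec.snd)
  exact Primrec.encode.comp ((initSeg_primrec this).comp Primrec.id
    (Primrec.nat_add.comp (Primrec.nat_add.comp (hn.comp Primrec.fst) Primrec.snd)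
      (Primrec.const 2)))

theorem useBound_primrec : Primrec₂ useBound :=
  Primrec₂.natPair.comp Primrec.snd (Primrec.nat_add.comp
    (Primrec.nat_add.comp Primrec.fst Primrec.snd) (Primrec.const 2))

theorem Reaches.congr_threshold {ext : ℕ → List Bool → ℕ → Option (List Bool)} {k k' : ℕ → ℕ}
    {t : ℕ} (hk : ∀ i < t, k i = k' i) {S : State} (h : Reaches ext k t S) : Reaches ext k' t S := by
  obtain ⟨s, hs⟩ := h
  exact ⟨s, by rwa [← run_congr (fun _ _ _ _ => rfl) hk]⟩

/-! ### The probability of getting stuck -/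

instance : IsProbabilityMeasure uniformMeasure :=
  inferInstanceAs (IsProbabilityMeasure (Measure.infinitePi _))

/-- The coin-flipping measure is invariant under bitwise exclusive or with a fixed sequence. -/
theorem measurePreserving_xor (a : Cantor) :
    MeasurePreserving (fun (x : Cantor) m => a m ^^ x m) uniformMeasure uniformMeasure := by
  have hm : ∀ m, Measurable fun b : Bool => a m ^^ b := fun m => measurable_from_top
  refine ⟨by fun_prop, ?_⟩
  rw [uniformMeasure, Measure.infinitePi_map_pi _ hm]
  congr 1
  funext m
  refine Measure.ext_of_singleton fun b => ?_
  have : (fun b : Bool => a m ^^ b) ⁻¹' {b} = {a m ^^ b} := by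
    ext c
    cases a m <;> cases b <;> cases c <;> simp
  rw [Measure.map_apply (hm m) (measurableSet_singleton b), this,
    PMF.toMeasure_apply_singleton _ _ (measurableSet_singleton _),
    PMF.toMeasure_apply_singleton _ _ (measurableSet_singleton _),
    PMF.uniformOfFintype_apply, PMF.uniformOfFintype_apply]

/-- The sequence that carries the word `v` at the beginning of its `i`-th column and is zero
elsewhere. -/
def mask (i : ℕ) {N : ℕ} (v : Fin N → Bool) : Cantor := fun m =>
  if h : m.unpair.1 = i ∧ m.unpair.2 < N then v ⟨m.unpair.2, h.2⟩ else false

theorem mask_pair (i : ℕ) {N : ℕ} (v : Fin N → Bool) (j : Fin N) :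
    mask i v (Nat.pair i j) = v j := by
  simp [mask]

theorem mask_of_ne {i i' : ℕ} (h : i' ≠ i) {N : ℕ} (v : Fin N → Bool) (j : ℕ) :
    mask i v (Nat.pair i' j) = false := by
  simp [mask, h]

/-- If points of a measurable set that agree outside of column `i` also agree on the first `N` bits
of column `i`, then the set has measure at most `2⁻ᴺ`, because its `2ᴺ` translates by words on
these bits are disjoint. -/
theorem measure_le_of_block_unique {i N : ℕ} {B : Set Cantor} (hB : MeasurableSet B)
    (h : ∀ x ∈ B, ∀ y ∈ B, (∀ i' ≠ i, ∀ j, x (Nat.pair i' j) = y (Nat.pair i' j)) →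
      ∀ j < N, x (Nat.pair i j) = y (Nat.pair i j)) :
    uniformMeasure B ≤ 2⁻¹ ^ N := by
  have hdisj : Pairwise (Function.onFun Disjoint fun v : Fin N → Bool =>
      (fun (x : Cantor) m => mask i v m ^^ x m) ⁻¹' B) := by
    intro v v' hv
    refine Set.disjoint_left.2 fun x hx hx' => hv (funext fun j => ?_)
    have := h _ hx _ hx' (fun i' hi' j => by simp only [mask_of_ne hi']) j j.2
    simpa [mask_pair] using this
  have hsum : ∑' v : Fin N → Bool,
      uniformMeasure ((fun (x : Cantor) m => mask i v m ^^ x m) ⁻¹' B) ≤ 1 := by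
    rw [← measure_iUnion hdisj fun v => (measurePreserving_xor _).measurable hB]
    exact prob_le_one
  simp only [(measurePreserving_xor _).measure_preimage hB.nullMeasurableSet, tsum_fintype,
    Finset.sum_const, Finset.card_univ, Fintype.card_pi, Fintype.card_bool, Finset.prod_const,
    Fintype.card_fin, nsmul_eq_mul, Nat.cast_pow, Nat.cast_ofNat] at hsum
  rw [← ENNReal.inv_pow, ← one_div, ENNReal.le_div_iff_mul_le (by simp) (by simp), mul_comm]
  exact hsum

section

variable (ext : ℕ → List Bool → ℕ → Option (List Bool))

/-- Getting stuck happens at a finite stage, hence depends on finitely many random bits. -/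
theorem isOpen_stuck (n i : ℕ) : IsOpen {x : Cantor | Stuck ext (threshold n x) i} := by
  refine isOpen_iff_mem_nhds.2 ?_
  rintro x ⟨t, S, rfl, hS, hR, hk, hn⟩
  refine mem_of_superset ((PiNat.isOpen_cylinder (fun _ => Bool) x (useBound n (t + 1))).mem_nhds
    (PiNat.self_mem_cylinder _ _)) fun y hy => ?_
  have h : ∀ i < t + 1, threshold n x i = threshold n y i :=
    threshold_congr fun m hm => (hy m hm).symm
  exact ⟨t, S, rfl, hS.congr_threshold fun i hi => h i (by omega), hR,
    hk.trans (h _ (Nat.lt_succ_of_le (Nat.unpair_left_le t))), hn⟩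

theorem measure_stuck_le (n i : ℕ) :
    uniformMeasure {x : Cantor | Stuck ext (threshold n x) i} ≤ 2⁻¹ ^ (n + i + 2) := by
  refine measure_le_of_block_unique (i := i) (isOpen_stuck ext n i).measurableSet fun x hx y hy hxy => ?_
  have := Stuck.unique (fun i' hi' => ?_) hx hy
  · exact initSeg_injOn (Encodable.encode_injective this)
  · rw [threshold, threshold, initSeg_congr fun j _ => hxy i' hi' j]

/-- With probability greater than `1 - 2⁻ⁿ`, the process with thresholds at error level `n` runs
forever. -/
theorem lt_measure_reaches (n : ℕ) :
    1 - (1 / 2) ^ n <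
      uniformMeasure.real {x : Cantor | ∀ t, ∃ S, Reaches ext (threshold n x) t S} := by
  set B : Set Cantor := ⋃ i, {x : Cantor | Stuck ext (threshold n x) i}
  have hB : MeasurableSet B := MeasurableSet.iUnion fun i => (isOpen_stuck ext n i).measurableSet
  have h : uniformMeasure B ≤ 2⁻¹ ^ (n + 1) := by
    refine (measure_iUnion_le _).trans ((ENNReal.tsum_le_tsum (measure_stuck_le ext n)).trans ?_)
    have : ∀ i : ℕ, (2⁻¹ : ENNReal) ^ (n + i + 2) = 2⁻¹ ^ (n + 1) * 2⁻¹ ^ (i + 1) := fun i => by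
      rw [← pow_add]
      congr 1
      omega
    simp only [this, ENNReal.tsum_mul_left, ENNReal.tsum_geometric_add_one,
      ENNReal.one_sub_inv_two, inv_inv]
    rw [ENNReal.inv_mul_cancel (by simp) (by simp), mul_one]
  have h' : uniformMeasure.real B ≤ (1 / 2) ^ (n + 1) := by
    have := ENNReal.toReal_mono (by simp) h
    simpa [Measure.real] using this
  have hsub : Bᶜ ⊆ {x : Cantor | ∀ t, ∃ S, Reaches ext (threshold n x) t S} := fun x hx =>
    exists_reaches fun i hi => hx (Set.mem_iUnion.2 ⟨i, hi⟩)
  refine lt_of_lt_of_le ?_ (measureReal_mono hsub)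
  rw [probReal_compl_eq_one_sub hB]
  have : (1 / 2 : ℝ) ^ (n + 1) < (1 / 2) ^ n := by
    rw [pow_succ]
    have : (0 : ℝ) < (1 / 2) ^ n := by positivity
    linarith
  linarith

/-! ### The trees of successful runs -/

/-- The thresholds read off from a finite word, which is continued by zeros. -/
def wordThreshold (n : ℕ) (σ : List Bool) : ℕ → ℕ := threshold n fun m => σ.getD m false

theorem wordThreshold_initSeg {n t l : ℕ} (x : Cantor) (h : useBound n t ≤ l) :
    ∀ i < t, wordThreshold n (initSeg x l) i = threshold n x i :=
  threshold_congr fun _ hm => getD_initSeg x (hm.trans_le h) _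

/-- The tree of all words that allow the process at error level `n` to run for as many stages as
the word provides random bits for. -/
def runTree (n : ℕ) : BinTree :=
  ⟨{σ | ∀ t, useBound n t ≤ σ.length → ∃ S, Reaches ext (wordThreshold n σ) t S}, by
    intro σ a h t ht
    obtain ⟨S, hS⟩ := h t (by rw [List.length_append]; omega)
    refine ⟨S, hS.congr_threshold (threshold_congr fun m hm => ?_)⟩
    simp only [List.getD_eq_getElem?_getD]
    rw [List.getElem?_append_left (by omega)]⟩

theorem mem_runTree {n : ℕ} {σ : List Bool} : σ ∈ runTree ext n ↔
    ∀ t, useBound n t ≤ σ.length → ∃ S, Reaches ext (wordThreshold n σ) t S := Iff.rfl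

theorem paths_runTree (n : ℕ) :
    paths (runTree ext n) = {x : Cantor | ∀ t, ∃ S, Reaches ext (threshold n x) t S} := by
  ext x
  simp only [paths, Set.mem_ofPred_eq, ofFn_eq_initSeg, mem_runTree, length_initSeg]
  constructor
  · intro h t
    obtain ⟨S, hS⟩ := h _ t le_rfl
    exact ⟨S, hS.congr_threshold (wordThreshold_initSeg x le_rfl)⟩
  · intro h l t ht
    obtain ⟨S, hS⟩ := h t
    exact ⟨S, hS.congr_threshold fun i hi => (wordThreshold_initSeg x ht i hi).symm⟩

theorem runTree_mem_dom : runTree ext ∈ oneMinusStarWWKL.dom := fun n => by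
  change _ < uniformMeasure.real _
  rw [paths_runTree]
  exact lt_measure_reaches ext n

end

/-! ### The forward functional -/

/-- With search bound `s`, the process at error level `n` relative to `q` runs for as many stages
as the word `σ` provides random bits for. -/
def TreeTest (q : ℕ → ℕ) (s n : ℕ) (σ : List Bool) : Prop :=
  ∀ t < σ.length + 1, σ.length < useBound n t ∨
    (run (extension q) (wordThreshold n σ) s t).isSome = true

instance (q : ℕ → ℕ) (s n : ℕ) (σ : List Bool) : Decidable (TreeTest q s n σ) :=
  inferInstanceAs (Decidable (∀ t < σ.length + 1, _ ∨ _))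

/-- The `s`-th approximation to the characteristic function of the `n`-th tree. -/
def treeApprox (q : ℕ → ℕ) (s n j : ℕ) : ℕ :=
  ((Encodable.decode (α := List Bool) j).map fun σ =>
    if Encodable.encode σ = j ∧ TreeTest q s n σ then 1 else 0).getD 0

theorem treeApprox_eq_one {q : ℕ → ℕ} {s n : ℕ} {σ : List Bool} (h : TreeTest q s n σ) :
    treeApprox q s n (Encodable.encode σ) = 1 := by
  simp [treeApprox, h]

theorem treeApprox_eq_zero {q : ℕ → ℕ} {s n j : ℕ}
    (h : ∀ σ, Encodable.encode σ = j → ¬ TreeTest q s n σ) : treeApprox q s n j = 0 := by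
  rw [treeApprox]
  cases hd : Encodable.decode (α := List Bool) j with
  | none => rfl
  | some σ => simpa using h σ

theorem treeApprox_congr {q q' : ℕ → ℕ} {s n j : ℕ} (h : ∀ i < s + j + 1, q i = q' i) :
    treeApprox q s n j = treeApprox q' s n j := by
  have key : ∀ σ : List Bool, Encodable.encode σ = j → (TreeTest q s n σ ↔ TreeTest q' s n σ) := by
    rintro σ rfl
    refine forall_congr' fun t => forall_congr' fun ht => or_congr Iff.rfl ?_
    have := Encodable.length_le_encode σ
    rw [run_congr (fun i w m hm => extension_congr h i w (by omega)) fun _ _ => rfl]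
  unfold treeApprox
  congr 1
  refine Option.map_congr fun σ _ => if_congr (and_congr_right fun h => key σ h) rfl rfl

theorem treeTest_primrec {α : Type*} [Primcodable α] {q : α → ℕ → ℕ} {s n : α → ℕ}
    {σ : α → List Bool} (hq : Primrec₂ q) (hs : Primrec s) (hn : Primrec n) (hσ : Primrec σ) :
    PrimrecPred fun a => TreeTest (q a) (s a) (n a) (σ a) := by
  have hk : Primrec₂ fun a i => wordThreshold (n a) (σ a) i :=
    threshold_primrec hn ((Primrec.list_getD false).comp (hσ.comp Primrec.fst) Primrec.snd)
  have hrun : Primrec fun z : ℕ × α =>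
      run (extension (q z.2)) (wordThreshold (n z.2) (σ z.2)) (s z.2) z.1 :=
    (run_primrec (ext := fun a => extension (q a)) (extension_primrec hq) hk).comp
      (g := fun z : ℕ × α => (z.2, s z.2, z.1))
      (Primrec.pair Primrec.snd (Primrec.pair (hs.comp Primrec.snd) Primrec.fst))
  have hrel : PrimrecRel fun (t : ℕ) (a : α) => (σ a).length < useBound (n a) t ∨
      (run (extension (q a)) (wordThreshold (n a) (σ a)) (s a) t).isSome = true :=
    PrimrecPred.or (Primrec.nat_lt.comp (Primrec.list_length.comp (hσ.comp Primrec.snd))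
      (useBound_primrec.comp (hn.comp Primrec.snd) Primrec.fst))
      (Primrec.eq.comp (Primrec.option_isSome.comp hrun) (Primrec.const true))
  refine (hrel.forall_mem_list.comp (Primrec.list_range.comp (Primrec.succ.comp
    (Primrec.list_length.comp hσ))) Primrec.id).of_eq fun a => ?_
  simp [TreeTest]

theorem treeApprox_primrec {α : Type*} [Primcodable α] {q : α → ℕ → ℕ} {s n j : α → ℕ}
    (hq : Primrec₂ q) (hs : Primrec s) (hn : Primrec n) (hj : Primrec j) :
    Primrec fun a => treeApprox (q a) (s a) (n a) (j a) := by
  have hq' : Primrec₂ fun (z : α × List Bool) i => q z.1 i :=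
    hq.comp (Primrec.fst.comp Primrec.fst) Primrec.snd
  have htest := treeTest_primrec hq' (hs.comp Primrec.fst) (hn.comp Primrec.fst) Primrec.snd
  have hval : Primrec₂ fun (a : α) (σ : List Bool) =>
      if Encodable.encode σ = j a ∧ TreeTest (q a) (s a) (n a) σ then 1 else 0 :=
    Primrec.ite (PrimrecPred.and (Primrec.eq.comp (Primrec.encode.comp Primrec.snd)
      (hj.comp Primrec.fst)) htest) (Primrec.const 1) (Primrec.const 0)
  exact Primrec.option_getD.comp (Primrec.option_map (Primrec.decode.comp hj) hval)
    (Primrec.const 0)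

theorem TreeTest.mem_runTree {q : ℕ → ℕ} {s n : ℕ} {σ : List Bool} (h : TreeTest q s n σ) :
    σ ∈ runTree (extension q) n := fun t ht => by
  have := le_useBound n t
  have := (h t (by omega)).resolve_left (by omega)
  obtain ⟨S, hS⟩ := Option.isSome_iff_exists.1 this
  exact ⟨S, s, hS⟩

theorem eventually_treeTest {q : ℕ → ℕ} {n : ℕ} {σ : List Bool}
    (h : σ ∈ runTree (extension q) n) : ∀ᶠ s in atTop, TreeTest q s n σ := by
  refine (Set.finite_lt_nat _).eventually_all.2 fun t _ => ?_
  by_cases ht : σ.length < useBound n t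
  · exact Eventually.of_forall fun _ => Or.inl ht
  · obtain ⟨S, s₀, hS⟩ := h t (not_lt.1 ht)
    filter_upwards [eventually_ge_atTop s₀] with s hs
    exact Or.inr (Option.isSome_iff_exists.2 ⟨S, run_mono hs hS⟩)

/-- The forward functional: it maps `q` to approximations of the sequence of trees of successful
runs relative to `q`. -/
def forward : (ℕ → ℕ) →. (ℕ → ℕ) := fun q => Part.some fun N =>
  treeApprox q N.unpair.1 N.unpair.2.unpair.1 N.unpair.2.unpair.2

theorem forward_computable : ComputableFunctional forward := by
  have hN : Primrec fun z : List ℕ × ℕ => z.2.unpair := Primrec.unpair.comp Primrec.snd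
  have hN' : Primrec fun z : List ℕ × ℕ => z.2.unpair.2.unpair :=
    Primrec.unpair.comp (Primrec.snd.comp hN)
  have hg : Primrec₂ fun (l : List ℕ) (N : ℕ) =>
      if N.unpair.1 + N.unpair.2.unpair.2 + 1 ≤ l.length then
        some (treeApprox (fun i => l.getD i 0) N.unpair.1 N.unpair.2.unpair.1 N.unpair.2.unpair.2)
      else none := by
    refine Primrec.ite (Primrec.nat_le.comp (Primrec.succ.comp (Primrec.nat_add.comp
      (Primrec.fst.comp hN) (Primrec.snd.comp hN'))) (Primrec.list_length.comp Primrec.fst))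
      (Primrec.option_some.comp ?_) (Primrec.const none)
    exact treeApprox_primrec ((Primrec.list_getD 0).comp (Primrec.fst.comp Primrec.fst)
      Primrec.snd) (Primrec.fst.comp hN) (Primrec.fst.comp hN') (Primrec.snd.comp hN')
  refine computableFunctional_of_primrec hg fun q y hy N => ⟨⟨N.unpair.1 + N.unpair.2.unpair.2 + 1, ?_⟩,
    fun m b hb => ?_⟩
  · simp
  · obtain rfl := Part.mem_some_iff.1 hy
    split_ifs at hb with h
    · rw [length_initSeg] at h
      obtain rfl := Option.some.inj hb
      exact treeApprox_congr fun i hi => getD_initSeg q (by omega) 0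
    · simp at hb

/-- The approximations computed by the forward functional converge to a name of the sequence of
trees: a word in a tree passes the test for all large enough search bounds, and a word outside
of it for none. -/
theorem forward_names (q : ℕ → ℕ) : treeRep.seq.jump.Names
    (fun N => treeApprox q N.unpair.1 N.unpair.2.unpair.1 N.unpair.2.unpair.2)
    (runTree (extension q)) := by
  classical
  refine ⟨fun N => if ∃ w ∈ runTree (extension q) N.unpair.1, Encodable.encode w = N.unpair.2
    then 1 else 0, tendsto_pi_nhds.2 fun N => ?_, fun n j => ?_⟩
  · refine tendsto_const_nhds.congr' ?_
    simp only [column, Nat.unpair_pair]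
    split_ifs with h
    · obtain ⟨w, hw, e⟩ := h
      rw [← e]
      filter_upwards [eventually_treeTest hw] with s hs
      exact (treeApprox_eq_one hs).symm
    · exact Eventually.of_forall fun s =>
        (treeApprox_eq_zero fun σ e hσ => h ⟨σ, hσ.mem_runTree, e⟩).symm
  · simp only [column, Nat.unpair_pair]

/-! ### The backward functional -/

/-- The sequence `y` is produced by the process from the oracle `o = ⟨q, r⟩`, where `r` consists
of the error level and the random sequence. -/
def IsOutput (o y : ℕ → ℕ) : Prop := ∀ j, ∃ S : State,
  Reaches (extension fun i => o (2 * i)) (threshold (o 1) fun m => o (2 * m + 3) != 0) (j + 1) S ∧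
    y j = (S.1.getD j false).toNat

/-- The backward functional: it runs the process and is defined where this does not get stuck. -/
noncomputable def backward : (ℕ → ℕ) →. (ℕ → ℕ) := fun o =>
  ⟨∃ y, IsOutput o y, fun h => h.choose⟩

theorem isOutput_of_mem_backward {o y : ℕ → ℕ} (h : y ∈ backward o) : IsOutput o y := by
  obtain ⟨h, rfl⟩ := h
  exact h.choose_spec

theorem backward_computable : ComputableFunctional backward := by
  have hl : Primrec fun z : (List ℕ × ℕ) × ℕ => z.1.1 := Primrec.fst.comp Primrec.fst
  have hq : Primrec₂ fun (z : List ℕ × ℕ) i => z.1.getD (2 * i) 0 :=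
    (Primrec.list_getD 0).comp hl (Primrec.nat_double.comp Primrec.snd)
  have hx : Primrec₂ fun (z : List ℕ × ℕ) m => z.1.getD (2 * m + 3) 0 != 0 :=
    Primrec.not.comp (Primrec.beq.comp ((Primrec.list_getD 0).comp hl (Primrec.nat_add.comp
      (Primrec.nat_double.comp Primrec.snd) (Primrec.const 3))) (Primrec.const 0))
  have hn : Primrec fun z : List ℕ × ℕ => z.1.getD 1 0 :=
    (Primrec.list_getD 0).comp Primrec.fst (Primrec.const 1)
  have hlen : Primrec fun z : List ℕ × ℕ => z.1.length := Primrec.list_length.comp Primrec.fst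
  have hj : Primrec fun z : List ℕ × ℕ => z.2 + 1 := Primrec.succ.comp Primrec.snd
  have hg : Primrec₂ fun (l : List ℕ) (j : ℕ) =>
      if 2 * useBound (l.getD 1 0) (j + 1) + 3 ≤ l.length then
        (run (extension fun i => l.getD (2 * i) 0)
          (threshold (l.getD 1 0) fun m => l.getD (2 * m + 3) 0 != 0) (l.length / 2) (j + 1)).map
            fun S => (S.1.getD j false).toNat
      else none := by
    refine Primrec.ite (Primrec.nat_le.comp (Primrec.nat_add.comp (Primrec.nat_double.comp
      (useBound_primrec.comp hn hj)) (Primrec.const 3)) hlen) (Primrec.option_map ?_ ?_)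
      (Primrec.const none)
    · exact (run_primrec (ext := fun z : List ℕ × ℕ => extension fun i => z.1.getD (2 * i) 0)
        (k := fun z => threshold (z.1.getD 1 0) fun m => z.1.getD (2 * m + 3) 0 != 0)
        ((extension_primrec hq).of_eq fun _ => rfl) (threshold_primrec hn hx)).comp
        (g := fun z : List ℕ × ℕ => (z, z.1.length / 2, z.2 + 1)) (Primrec.pair
        Primrec.id (Primrec.pair (Primrec.nat_div.comp hlen (Primrec.const 2)) hj))
    · exact (Primrec.dom_bool _).comp ((Primrec.list_getD false).comp
        (Primrec.fst.comp Primrec.snd) (Primrec.snd.comp Primrec.fst))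
  have hrun : ∀ (o : ℕ → ℕ) j m, 2 * useBound (o 1) (j + 1) + 3 ≤ m →
      run (extension fun i => (initSeg o m).getD (2 * i) 0)
        (threshold (o 1) fun i => (initSeg o m).getD (2 * i + 3) 0 != 0) (m / 2) (j + 1) =
      run (extension fun i => o (2 * i)) (threshold (o 1) fun m => o (2 * m + 3) != 0)
        (m / 2) (j + 1) := by
    intro o j m hm
    have := le_useBound (o 1) (j + 1)
    refine run_congr (fun i w n hn' => extension_congr (N := max (m / 2) (j + 1))
      (fun i hi => getD_initSeg o (by omega) 0) i w hn') (threshold_congr fun i hi => ?_)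
    rw [getD_initSeg o (by omega)]
  refine computableFunctional_of_primrec hg fun o y hy j => ?_
  obtain ⟨S, ⟨s, hs⟩, hyj⟩ := isOutput_of_mem_backward hy j
  refine ⟨⟨max (2 * s) (2 * useBound (o 1) (j + 1) + 3), ?_⟩, fun m b hb => ?_⟩
  · rw [length_initSeg, getD_initSeg o (by omega), if_pos (le_max_right _ _),
      hrun _ _ _ (le_max_right _ _), run_mono (by omega) hs]
    rfl
  · rw [length_initSeg] at hb
    split_ifs at hb with h
    · rw [getD_initSeg o (by omega)] at hb h
      rw [hrun _ _ _ h] at hb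
      obtain ⟨S', hS', rfl⟩ := Option.map_eq_some_iff.1 hb
      rw [hyj, Reaches.unique ⟨_, hS'⟩ ⟨s, hs⟩]
    · simp at hb

/-! ### Genericity of the output -/

/-- The words produced by the process are the initial segments of its output. -/
theorem Reaches.eq_initSeg {q : ℕ → ℕ} {k : ℕ → ℕ} {z : Cantor}
    (hz : ∀ j, ∃ S : State, Reaches (extension q) k (j + 1) S ∧ z j = S.1.getD j false)
    {t : ℕ} {S : State} (hS : Reaches (extension q) k t S) : S.1 = initSeg z S.1.length := by
  refine List.ext_getElem? fun j => ?_
  rw [getElem?_initSeg]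
  split_ifs with hj
  · obtain ⟨S', hS', e⟩ := hz j
    have hj' : j < S'.1.length := hS'.le_length fun _ _ _ _ => extension_isPrefix
    have hcomp : S'.1[j]? = S.1[j]? := by
      rcases le_total t (j + 1) with h | h
      · obtain ⟨v, hv⟩ := hS.isPrefix (fun _ _ _ _ => extension_isPrefix) h hS'
        rw [← hv, List.getElem?_append_left hj]
      · obtain ⟨v, hv⟩ := hS'.isPrefix (fun _ _ _ _ => extension_isPrefix) h hS
        rw [← hv, List.getElem?_append_left hj']
    rw [← hcomp, e, List.getD_eq_getElem?_getD, List.getElem?_eq_getElem hj', Option.getD_some]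
  · exact List.getElem?_eq_none (not_lt.1 hj)

/-- The output of a process that runs forever is 1-generic, whatever the thresholds are. -/
theorem isOneGeneric_of_reaches {q z : Cantor} {k : ℕ → ℕ}
    (hz : ∀ j, ∃ S : State, Reaches (extension q.toBaire) k (j + 1) S ∧ z j = S.1.getD j false) :
    IsOneGeneric q z := by
  intro c
  obtain ⟨i, hi⟩ := exists_extension_index c
  have hall : ∀ t, ∃ S, Reaches (extension q.toBaire) k t S
    | 0 => ⟨_, reaches_zero⟩
    | j + 1 => (hz j).imp fun _ h => h.1
  have hcyl : ∀ {u : List Bool} {y : Cantor}, u = initSeg z u.length →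
      y ∈ PiNat.cylinder z u.length → u = initSeg y u.length := fun {u y} hu hy =>
    hu.trans (initSeg_congr fun i hi => (hy i hi).symm)
  rcases meets_requirement (fun _ _ _ _ => extension_isPrefix) hall i with
    ⟨t, S, w, s, u, hS, hu, hp⟩ | ⟨t, S, g, hS, hp, hg⟩
  · have hu' : u = initSeg z u.length :=
      eq_initSeg_of_isPrefix (n := S.1.length) (by rwa [← hS.eq_initSeg hz])
    exact ⟨u.length, Or.inl fun y hy => (hi q y).1 w s u _ hu (hcyl hu' hy)⟩
  · have hg' : g = initSeg z g.length :=
      eq_initSeg_of_isPrefix (n := S.1.length) (by rwa [← hS.eq_initSeg hz])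
    refine ⟨g.length, Or.inr (Set.eq_empty_iff_forall_notMem.2 fun y hy => ?_)⟩
    obtain ⟨s, hs⟩ := (hi q y).2 hy.2 g.length
    rw [← hcyl hg' hy.1] at hs
    exact hs (hg s)

/-- The backward functional works along every path of the tree at any error level. -/
theorem backward_spec {q x : Cantor} {n : ℕ} {r : ℕ → ℕ} (h0 : r 0 = n)
    (hr : (fun m => r (m + 1)) = x.toBaire) (hx : x ∈ paths (runTree (extension q.toBaire) n)) :
    ∃ y ∈ backward (interleave q.toBaire r), ∃ z : Cantor, IsOneGeneric q z ∧ y = z.toBaire := by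
  rw [paths_runTree] at hx
  have h₁ : (fun i => interleave q.toBaire r (2 * i)) = q.toBaire := by
    funext i
    simp [interleave]
  have h₂ : interleave q.toBaire r 1 = n := h0
  have h₃ : (fun m => interleave q.toBaire r (2 * m + 3) != 0) = x := by
    funext m
    have : (2 * m + 3) / 2 = m + 1 := by omega
    rw [interleave, if_neg (by omega), this, congrFun hr m, Cantor.toBaire]
    cases x m <;> rfl
  choose S hS using hx
  have hout : ∃ y, IsOutput (interleave q.toBaire r) y :=
    ⟨fun j => ((S (j + 1)).1.getD j false).toNat, fun j => ⟨S (j + 1), by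
      rw [h₁, h₂, h₃]
      exact hS _, rfl⟩⟩
  refine ⟨_, ⟨hout, rfl⟩, fun j => (S (j + 1)).1.getD j false,
    isOneGeneric_of_reaches (k := threshold n x) fun j => ⟨S (j + 1), hS _, rfl⟩, ?_⟩
  funext j
  obtain ⟨S', hS', e⟩ := hout.choose_spec j
  rw [h₁, h₂, h₃] at hS'
  exact e.trans (by rw [hS'.unique (hS _)]; rfl)

end Weihrauch

theorem theorem10p6 :
    Weihrauch.Reducible
      Weihrauch.cantorRep Weihrauch.cantorRep
      Weihrauch.treeRep.seq.jump Weihrauch.cantorRep.natCoprod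
      Weihrauch.oneGEN Weihrauch.oneMinusStarWWKL := by
  refine ⟨Weihrauch.forward, Weihrauch.backward, Weihrauch.forward_computable,
    Weihrauch.backward_computable, fun G hG p q hp _ => ?_⟩
  obtain rfl : p = q.toBaire := hp
  obtain ⟨r, hr, ⟨n, x⟩, hx, h0, hr'⟩ :=
    hG _ _ (Weihrauch.forward_names q.toBaire) (Weihrauch.runTree_mem_dom _)
  obtain ⟨y, hy, z, hz, hyz⟩ := Weihrauch.backward_spec h0 hr' hx
  exact ⟨y, Part.mem_bind_iff.2 ⟨_, Part.mem_some _, Part.mem_bind_iff.2 ⟨r, hr, hy⟩⟩, z, hz, hyz⟩
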